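/- Let $n\ge 3$, let $\mathcal X=\mathcal Y$ be an alphabet of size $n$, and let $\alpha\in(0,\frac1n)\cup(\frac1n,\frac1{n-1})$. Let $X$ be uniform on $\mathcal X$, and let $Y$ be the output, on input $X$, of the Hamming channel $\mathcal H_{n,\alpha}$, that is, $p_{Y|X}(y|x)=1-(n-1)\alpha$ if $x=y$ and $p_{Y|X}(y|x)=\alpha$ if $x\ne y$. With natural logarithms, put for $R\in[0,\log n]$ $$\mathrm{IB}(R)=\max_{p_{T|X}:\ Y-X-T,\ I(X;T)\le R} I(Y;T),\qquad \varphi(R)=\max_{p:\ \log n-H(p)\le R}\bigl(\log n-H(p\,\mathcal H_{n,\alpha})\bigr),$$ where $T$ ranges over all random variables with values in a finite alphabet (of any size) such that $Y-X-T$ is a Markov chain, $p$ ranges over all probability distributions on $\mathcal X$, $H$ is Shannon entropy, $I$ is mutual information, and $p\,\mathcal H_{n,\alpha}$ is the output distribution of the channel for the input distribution $p$. Then both maxima are attained for every $R\in[0,\log n]$, $\varphi$ is differentiable on $(0,\log n)$, there is a unique $R_c\in(0,\log n)$ with $\varphi'(R_c)=\varphi(R_c)/R_c$, and $$\mathrm{IB}(R)=\begin{cases}\dfrac{\varphi(R_c)}{R_c}\,R,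 & R\in[0,R_c],\\[2mm] \varphi(R), & R\in(R_c,\log n].\end{cases}$$ In particular, $\mathrm{IB}$ is linear on $[0,R_c]$, although the joint distribution of $X$ and $Y$ has full support: $p_{X,Y}(x,y)>0$ for all $x,y\in\mathcal X$. -/

import Mathlib

open Set

namespace InfoBottleneck

noncomputable section

/-- A channel (conditional distribution) from `A` to `B`: every row `W a` is a probability
vector on `B`; `W a b` is the probability of `b` given `a`. -/
def IsChannel {A B : Type*} [Fintype B] (W : A → B → ℝ) : Prop :=
  ∀ a, W a ∈ stdSimplex ℝ B

/-- Shannon entropy `H(p) = - ∑ a, p a * log (p a)`, in nats, with `0 log 0 = 0`. -/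
def entropy {A : Type*} [Fintype A] (p : A → ℝ) : ℝ :=
  ∑ a, Real.negMulLog (p a)

/-- Mutual information `I(A;B) = H(A) + H(B) - H(A,B)` of a joint distribution `q` on `A × B`. -/
def mutualInfo {A B : Type*} [Fintype A] [Fintype B] (q : A → B → ℝ) : ℝ :=
  entropy (fun a => ∑ b, q a b) + entropy (fun b => ∑ a, q a b)
    - entropy (fun ab : A × B => q ab.1 ab.2)

/-- The joint distribution of the input and the output of the channel `W` with input law `p`. -/
def jointLaw {A B : Type*} (p : A → ℝ) (W : A → B → ℝ) : A → B → ℝ :=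
  fun a b => p a * W a b

/-- The distribution of the output of the channel `W` with input law `p`. -/
def outputLaw {A B : Type*} [Fintype A] (p : A → ℝ) (W : A → B → ℝ) : B → ℝ :=
  fun b => ∑ a, p a * W a b

/-- The joint distribution of `(Y, T)` when `X` has law `p`, `Y` is the output of the channel `W`
and `T` the output of the channel `Q` on input `X`, and `Y - X - T` is a Markov chain, that is,
`P(Y = y, X = x, T = t) = p x * W x y * Q x t`. -/
def markovLaw {X Y T : Type*} [Fintype X] (p : X → ℝ) (W : X → Y → ℝ) (Q : X → T → ℝ) :
    Y → T → ℝ :=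
  fun y t => ∑ x, p x * W x y * Q x t

/-- The values `I(Y;T)` over all representations `T` of `X` on a finite alphabet (of any size `m`)
with `Y - X - T` a Markov chain and `I(X;T) ≤ R`. -/
def ibValues {X Y : Type*} [Fintype X] [Fintype Y] (p : X → ℝ) (W : X → Y → ℝ) (R : ℝ) : Set ℝ :=
  {v | ∃ (m : ℕ) (Q : X → Fin m → ℝ), IsChannel Q ∧
    mutualInfo (jointLaw p Q) ≤ R ∧ v = mutualInfo (markovLaw p W Q)}

/-- The information bottleneck function `IB(R, p_X, p_{Y|X})`. -/
def ib {X Y : Type*} [Fintype X] [Fintype Y] (p : X → ℝ) (W : X → Y → ℝ) (R : ℝ) : ℝ :=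
  sSup (ibValues p W R)

/-- The uniform distribution. -/
def uniformLaw (X : Type*) [Fintype X] : X → ℝ :=
  fun _ => 1 / (Fintype.card X : ℝ)

/-- The Hamming channel on the alphabet `X` with crossover probability `α`. -/
def hammingChannel (X : Type*) [Fintype X] [DecidableEq X] (α : ℝ) : X → X → ℝ :=
  fun x y => if x = y then 1 - ((Fintype.card X : ℝ) - 1) * α else α

/-- The values `log n - H(Y)` over all input laws `p` on `X`, `|X| = n`, such that
`log n - H(X) ≤ R`; here `Y` is the output of the channel `W` from `X` to `X`. -/
def phiValues {X : Type*} [Fintype X] (W : X → X → ℝ) (R : ℝ) : Set ℝ :=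
  {v | ∃ p ∈ stdSimplex ℝ X, Real.log (Fintype.card X) - entropy p ≤ R ∧
    v = Real.log (Fintype.card X) - entropy (outputLaw p W)}

/-- The function `φ(R)` of the channel `W`. -/
def phi {X : Type*} [Fintype X] (W : X → X → ℝ) (R : ℝ) : ℝ :=
  sSup (phiValues W R)

end

end InfoBottleneck

namespace InfoBottleneck

open Real Filter Topology

theorem strictMonoOn_of_hasDerivAt_pos {f f' : ℝ → ℝ} {D : Set ℝ} (hD : Convex ℝ D)
    (hc : ContinuousOn f D) (hd : ∀ x ∈ interior D, HasDerivAt f (f' x) x)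
    (hp : ∀ x ∈ interior D, 0 < f' x) : StrictMonoOn f D :=
  strictMonoOn_of_deriv_pos hD hc fun x hx => by rw [(hd x hx).deriv]; exact hp x hx

theorem strictAntiOn_of_hasDerivAt_neg {f f' : ℝ → ℝ} {D : Set ℝ} (hD : Convex ℝ D)
    (hc : ContinuousOn f D) (hd : ∀ x ∈ interior D, HasDerivAt f (f' x) x)
    (hp : ∀ x ∈ interior D, f' x < 0) : StrictAntiOn f D :=
  strictAntiOn_of_deriv_neg hD hc fun x hx => by rw [(hd x hx).deriv]; exact hp x hx

/-- A function that starts from `0`, first increases and then decreases, and takes a negative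
value, changes sign exactly once. -/
theorem exists_sign_change_of_deriv {l r m : ℝ} (hm : m ∈ Ioo l r) {F F' : ℝ → ℝ}
    (hc : ContinuousOn F (Ico l r)) (hl : F l = 0)
    (hd : ∀ x ∈ Ioo l r, HasDerivAt F (F' x) x)
    (hpos : ∀ x ∈ Ioo l m, 0 < F' x) (hneg : ∀ x ∈ Ioo m r, F' x < 0)
    (hend : ∃ x ∈ Ioo l r, F x < 0) :
    ∃ k ∈ Ioo m r, F k = 0 ∧ (∀ x ∈ Ioo l k, 0 < F x) ∧ ∀ x ∈ Ioo k r, F x < 0 := by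
  obtain ⟨hlm, hmr⟩ := hm
  have hmono : StrictMonoOn F (Icc l m) := by
    refine strictMonoOn_of_hasDerivAt_pos (f' := F') (convex_Icc _ _)
      (hc.mono fun x hx => ⟨hx.1, hx.2.trans_lt hmr⟩) ?_ ?_ <;> rw [interior_Icc]
    · exact fun x hx => hd x ⟨hx.1, hx.2.trans hmr⟩
    · exact hpos
  have hanti : StrictAntiOn F (Ico m r) := by
    refine strictAntiOn_of_hasDerivAt_neg (f' := F') (convex_Ico _ _)
      (hc.mono fun x hx => ⟨hlm.le.trans hx.1, hx.2⟩) ?_ ?_ <;> rw [interior_Ico]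
    · exact fun x hx => hd x ⟨hlm.trans hx.1, hx.2⟩
    · exact hneg
  have hpos' : ∀ x ∈ Ioc l m, 0 < F x := fun x hx => by
    rw [← hl]; exact hmono ⟨le_rfl, hlm.le⟩ ⟨hx.1.le, hx.2⟩ hx.1
  obtain ⟨x0, hx0, hx0F⟩ := hend
  have hmx : m < x0 := by
    by_contra h
    exact absurd (hpos' x0 ⟨hx0.1, not_lt.1 h⟩) hx0F.not_gt
  have hcc : ContinuousOn F (Icc m x0) :=
    hc.mono fun x hx => ⟨hlm.le.trans hx.1, hx.2.trans_lt hx0.2⟩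
  obtain ⟨k, hk, hkF⟩ := intermediate_value_Ioo' hmx.le hcc ⟨hx0F, hpos' m ⟨hlm, le_rfl⟩⟩
  have hkr : k < r := hk.2.trans hx0.2
  refine ⟨k, ⟨hk.1, hkr⟩, hkF, fun x hx => ?_, fun x hx => ?_⟩
  · rcases le_or_gt x m with h | h
    · exact hpos' x ⟨hx.1, h⟩
    · rw [← hkF]; exact hanti ⟨h.le, hx.2.trans hkr⟩ ⟨hk.1.le, hkr⟩ hx.2
  · rw [← hkF]; exact hanti ⟨hk.1.le, hkr⟩ ⟨hk.1.le.trans hx.1.le, hx.2⟩ hx.1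

/-- A quadratic polynomial which is positive at `l` and negative at `r` changes sign exactly once
between `l` and `r`. -/
theorem exists_sign_change_quadratic {l r e₀ e₁ e₂ : ℝ} (hlr : l < r)
    (hl : 0 < e₀ + e₁ * l + e₂ * l ^ 2) (hr : e₀ + e₁ * r + e₂ * r ^ 2 < 0) :
    ∃ m ∈ Ioo l r, (∀ x ∈ Ioo l m, 0 < e₀ + e₁ * x + e₂ * x ^ 2) ∧
      ∀ x ∈ Ioo m r, e₀ + e₁ * x + e₂ * x ^ 2 < 0 := by
  have hc : ContinuousOn (fun x : ℝ => e₀ + e₁ * x + e₂ * x ^ 2) (Icc l r) := by fun_prop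
  obtain ⟨m, hm, hm0⟩ := intermediate_value_Ioo' hlr.le hc ⟨hr, hl⟩
  simp only at hm0
  have key : ∀ x, e₀ + e₁ * x + e₂ * x ^ 2 = (x - m) * (e₁ + e₂ * (x + m)) := fun x => by
    linear_combination hm0
  rw [key] at hl hr
  have h1 : e₁ + e₂ * (l + m) < 0 := by
    by_contra h
    nlinarith [hm.1]
  have h2 : e₁ + e₂ * (r + m) < 0 := by
    by_contra h
    nlinarith [hm.2]
  have h3 : ∀ x ∈ Ioo l r, e₁ + e₂ * (x + m) < 0 := fun x hx => by
    rcases le_total e₂ 0 with h | h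
    · nlinarith [hx.1]
    · nlinarith [hx.2]
  refine ⟨m, hm, fun x hx => ?_, fun x hx => ?_⟩ <;> rw [key]
  · exact mul_pos_of_neg_of_neg (by linarith [hx.2]) (h3 x ⟨hx.1, hx.2.trans hm.2⟩)
  · exact mul_neg_of_pos_of_neg (by linarith [hx.1]) (h3 x ⟨hm.1.trans hx.1, hx.2⟩)

/-- The divergence `log N - H(p)` of `p = (a, b, …, b)`, `b = (1 - a) / (N - 1)`, from the uniform
law on `N` letters. -/
noncomputable def spikeDiv (N a : ℝ) : ℝ :=
  log N - negMulLog a - (N - 1) * negMulLog ((1 - a) / (N - 1))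

/-- The logarithm of the ratio `a / b` of the two values of `(a, b, …, b)`. -/
noncomputable def logOdds (N a : ℝ) : ℝ :=
  log a - log ((1 - a) / (N - 1))

theorem continuous_spikeDiv (N : ℝ) : Continuous (spikeDiv N) := by
  unfold spikeDiv
  have := continuous_negMulLog
  fun_prop

theorem hasDerivAt_spikeDiv {N a : ℝ} (hN : 1 < N) (ha : a ∈ Ioo (0 : ℝ) 1) :
    HasDerivAt (spikeDiv N) (logOdds N a) a := by
  have hN' : N - 1 ≠ 0 := by linarith
  have hb : (1 - a) / (N - 1) ≠ 0 := div_ne_zero (by linarith [ha.2]) hN'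
  have h1 : HasDerivAt (fun a : ℝ => (1 - a) / (N - 1)) (-1 / (N - 1)) a :=
    ((hasDerivAt_id a).const_sub 1).div_const _
  have h2 := ((hasDerivAt_negMulLog hb).comp a h1).const_mul (N - 1)
  refine (((hasDerivAt_negMulLog ha.1.ne').const_sub (log N)).sub h2).congr_deriv ?_
  unfold logOdds
  field_simp
  ring

theorem hasDerivAt_logOdds {N a : ℝ} (hN : 1 < N) (ha : a ∈ Ioo (0 : ℝ) 1) :
    HasDerivAt (logOdds N) (1 / (a * (1 - a))) a := by
  have hN' : N - 1 ≠ 0 := by linarith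
  have ha' : 1 - a ≠ 0 := by linarith [ha.2]
  have hb : (1 - a) / (N - 1) ≠ 0 := div_ne_zero ha' hN'
  have h1 : HasDerivAt (fun a : ℝ => (1 - a) / (N - 1)) (-1 / (N - 1)) a :=
    ((hasDerivAt_id a).const_sub 1).div_const _
  refine ((hasDerivAt_log ha.1.ne').sub (h1.log hb)).congr_deriv ?_
  have := ha.1.ne'
  field_simp
  ring

theorem hasStrictDerivAt_spikeDiv {N a : ℝ} (hN : 1 < N) (ha : a ∈ Ioo (0 : ℝ) 1) :
    HasStrictDerivAt (spikeDiv N) (logOdds N a) a :=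
  hasStrictDerivAt_of_hasDerivAt_of_continuousAt
    (Filter.eventually_of_mem (Ioo_mem_nhds ha.1 ha.2) fun _ hx => hasDerivAt_spikeDiv hN hx)
    (hasDerivAt_logOdds hN ha).continuousAt

theorem logOdds_pos {N a : ℝ} (hN : 1 < N) (ha : a ∈ Ioo (1 / N) 1) : 0 < logOdds N a := by
  have h1 := ha.1
  rw [div_lt_iff₀ (by linarith)] at h1
  exact sub_pos.2 (log_lt_log (div_pos (by linarith [ha.2]) (by linarith))
    (by rw [div_lt_iff₀ (by linarith)]; nlinarith))

theorem logOdds_neg {N a : ℝ} (hN : 1 < N) (ha : a ∈ Ioo 0 (1 / N)) : logOdds N a < 0 := by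
  have h1 := ha.2
  rw [lt_div_iff₀ (by linarith)] at h1
  exact sub_neg.2 (log_lt_log ha.1 (by rw [lt_div_iff₀ (by linarith)]; nlinarith))

theorem one_sub_inv_div {N : ℝ} (hN : 1 < N) : (1 - 1 / N) / (N - 1) = 1 / N := by
  have h1 : N ≠ 0 := by linarith
  have h2 : N - 1 ≠ 0 := by linarith
  field_simp

theorem logOdds_one_div {N : ℝ} (hN : 1 < N) : logOdds N (1 / N) = 0 := by
  rw [logOdds, one_sub_inv_div hN, sub_self]

theorem spikeDiv_one_div {N : ℝ} (hN : 1 < N) : spikeDiv N (1 / N) = 0 := by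
  have h1 : N ≠ 0 := by linarith
  rw [spikeDiv, one_sub_inv_div hN, negMulLog, one_div, log_inv]
  field_simp
  ring

theorem spikeDiv_one {N : ℝ} : spikeDiv N 1 = log N := by simp [spikeDiv]

theorem one_div_mem_Ioo {N : ℝ} (hN : 1 < N) : 1 / N ∈ Ioo (0 : ℝ) 1 :=
  ⟨by positivity, by rw [div_lt_one (by linarith)]; exact hN⟩

theorem strictMonoOn_spikeDiv {N : ℝ} (hN : 1 < N) :
    StrictMonoOn (spikeDiv N) (Icc (1 / N) 1) := by
  refine strictMonoOn_of_hasDerivAt_pos (f' := logOdds N) (convex_Icc _ _)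
    (continuous_spikeDiv N).continuousOn ?_ ?_ <;> rw [interior_Icc]
  · exact fun x hx => hasDerivAt_spikeDiv hN ⟨(one_div_mem_Ioo hN).1.trans hx.1, hx.2⟩
  · exact fun x hx => logOdds_pos hN hx

theorem spikeDiv_pos {N a : ℝ} (hN : 1 < N) (ha : a ∈ Ioc (1 / N) 1) : 0 < spikeDiv N a := by
  rw [← spikeDiv_one_div hN]
  exact strictMonoOn_spikeDiv hN ⟨le_rfl, ha.1.le.trans ha.2⟩ ⟨ha.1.le, ha.2⟩ ha.1

theorem exists_spikeDiv_eq {N R : ℝ} (hN : 1 < N) (hR : R ∈ Icc 0 (log N)) :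
    ∃ a ∈ Icc (1 / N) 1, spikeDiv N a = R := by
  have := intermediate_value_Icc (one_div_mem_Ioo hN).2.le (continuous_spikeDiv N).continuousOn
  rw [spikeDiv_one_div hN, spikeDiv_one] at this
  exact this hR

theorem tendsto_logOdds_one {N : ℝ} (hN : 1 < N) : Tendsto (logOdds N) (𝓝[<] 1) atTop := by
  have h1 : Tendsto (fun a : ℝ => (1 - a) / (N - 1)) (𝓝[<] 1) (𝓝[>] 0) := by
    refine tendsto_nhdsWithin_iff.2 ⟨?_, ?_⟩
    · have : Continuous fun a : ℝ => (1 - a) / (N - 1) := by fun_prop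
      simpa using (this.tendsto 1).mono_left nhdsWithin_le_nhds
    · filter_upwards [self_mem_nhdsWithin] with a ha
      exact div_pos (sub_pos.2 ha) (sub_pos.2 hN)
  have h2 := tendsto_log_nhdsGT_zero.comp h1
  have h3 : Tendsto log (𝓝[<] 1) (𝓝 (log 1)) :=
    (continuousAt_log one_ne_zero).tendsto.mono_left nhdsWithin_le_nhds
  refine (h3.add_atTop (tendsto_neg_atBot_atTop.comp h2)).congr fun a => ?_
  simp [logOdds, sub_eq_add_neg]

/-- The function `a (1 - a) logOdds N a` is continuous at the end points too. -/
theorem continuousOn_mul_logOdds {N : ℝ} (hN : 1 < N) :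
    ContinuousOn (fun a => a * (1 - a) * logOdds N a) (Icc 0 1) := by
  have h : Continuous fun a => -((1 - a) * negMulLog a)
      + (N - 1) * a * negMulLog ((1 - a) / (N - 1)) := by
    have := continuous_negMulLog
    fun_prop
  refine h.continuousOn.congr fun a _ => ?_
  have hN' : N - 1 ≠ 0 := by linarith
  simp only [negMulLog, logOdds]
  field_simp
  ring

/-- The parameters of a Hamming channel on `N ≥ 3` letters: crossover probability `α > 0`,
contraction factor `c ≠ 0`, diagonal entry `α + c > 0`. -/
structure HammingParam (N α c : ℝ) : Prop where
  three_le : 3 ≤ N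
  pos : 0 < α
  ne_zero : c ≠ 0
  add_pos : 0 < α + c
  sum_eq : N * α + c = 1

namespace HammingParam

variable {N α c : ℝ}

theorem one_lt (h : HammingParam N α c) : 1 < N := by linarith [h.three_le]

theorem out_mem (h : HammingParam N α c) {x : ℝ} (hx : x ∈ Icc (0 : ℝ) 1) :
    α + c * x ∈ Ioo (0 : ℝ) 1 := by
  have e : c = 1 - N * α := by linarith [h.sum_eq]
  have h1 := h.pos
  have h2 := h.add_pos
  have h3 := h.three_le
  obtain ⟨h4, h5⟩ := hx
  have h6 : 0 < (N - 1) * α := mul_pos (by linarith) h1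
  have h7 : 0 < (N - 2) * α := mul_pos (by linarith) h1
  constructor
  · rcases h4.eq_or_lt with rfl | h4
    · linarith
    · nlinarith [mul_nonneg h1.le (sub_nonneg.2 h5), mul_pos h2 h4]
  · have : 1 - (α + c * x) = (1 - x) * ((N - 2) * α + (α + c)) + x * ((N - 1) * α) := by
      rw [e]; ring
    rcases h4.eq_or_lt with rfl | h4
    · nlinarith
    · nlinarith [mul_nonneg (sub_nonneg.2 h5) (_root_.add_pos h7 h2).le, mul_pos h4 h6]

theorem c_lt_one (h : HammingParam N α c) : c < 1 := by
  nlinarith [h.sum_eq, h.pos, h.three_le]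

theorem out_one_div (h : HammingParam N α c) : α + c * (1 / N) = 1 / N := by
  have h1 : N ≠ 0 := by linarith [h.three_le]
  field_simp
  linarith [h.sum_eq]

theorem out_sub (h : HammingParam N α c) (x : ℝ) : α + c * x - 1 / N = c * (x - 1 / N) := by
  linear_combination h.out_one_div

theorem hasDerivAt_out (x : ℝ) : HasDerivAt (fun x => α + c * x) c x := by
  simpa using ((hasDerivAt_id x).const_mul c).const_add α

theorem c_mul_logOdds_pos (h : HammingParam N α c) {a : ℝ} (ha : a ∈ Ioc (1 / N) 1) :
    0 < c * logOdds N (α + c * a) := by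
  have ha0 : 0 < a := (one_div_mem_Ioo h.one_lt).1.trans ha.1
  have hm := h.out_mem ⟨ha0.le, ha.2⟩
  have hs := h.out_sub a
  have ha1 : 0 < a - 1 / N := sub_pos.2 ha.1
  rcases lt_or_gt_of_ne h.ne_zero with hc | hc
  · exact mul_pos_of_neg_of_neg hc (logOdds_neg h.one_lt ⟨hm.1, by nlinarith⟩)
  · exact mul_pos hc (logOdds_pos h.one_lt ⟨by nlinarith, hm.2⟩)

theorem hasDerivAt_outDiv (h : HammingParam N α c) {a : ℝ} (ha : a ∈ Ioo (0 : ℝ) 1) :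
    HasDerivAt (fun a => spikeDiv N (α + c * a)) (c * logOdds N (α + c * a)) a := by
  have := (hasDerivAt_spikeDiv h.one_lt (h.out_mem ⟨ha.1.le, ha.2.le⟩)).comp a
    (hasDerivAt_out a)
  exact this.congr_deriv (mul_comm _ _)

theorem continuous_outDiv : Continuous fun a => spikeDiv N (α + c * a) :=
  (continuous_spikeDiv N).comp (by fun_prop)

theorem strictMonoOn_outDiv (h : HammingParam N α c) :
    StrictMonoOn (fun a => spikeDiv N (α + c * a)) (Icc (1 / N) 1) := by
  refine strictMonoOn_of_hasDerivAt_pos (f' := fun a => c * logOdds N (α + c * a))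
    (convex_Icc _ _) continuous_outDiv.continuousOn ?_ ?_ <;> rw [interior_Icc]
  · exact fun x hx => h.hasDerivAt_outDiv ⟨(one_div_mem_Ioo h.one_lt).1.trans hx.1, hx.2⟩
  · exact fun x hx => h.c_mul_logOdds_pos ⟨hx.1, hx.2.le⟩

theorem outDiv_one_div (h : HammingParam N α c) : spikeDiv N (α + c * (1 / N)) = 0 := by
  rw [h.out_one_div, spikeDiv_one_div h.one_lt]

theorem exists_quadratic_sign_change (h : HammingParam N α c) : ∃ m ∈ Ioo (1 / N) 1,
    (∀ x ∈ Ioo (1 / N) m, 0 < (1 - 2 * x) * ((α + c * x) * (1 - (α + c * x)))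
      - c * (1 - 2 * (α + c * x)) * (x * (1 - x))) ∧
    (∀ x ∈ Ioo m 1, (1 - 2 * x) * ((α + c * x) * (1 - (α + c * x)))
      - c * (1 - 2 * (α + c * x)) * (x * (1 - x)) < 0) := by
  have key : ∀ x, (1 - 2 * x) * ((α + c * x) * (1 - (α + c * x)))
      - c * (1 - 2 * (α + c * x)) * (x * (1 - x)) =
      α * (1 - α) + (-2 * (α * (1 - α))) * x + (c ^ 2 - c * (1 - 2 * α)) * x ^ 2 := fun x => by
    ring
  have hu := one_div_mem_Ioo h.one_lt
  simp only [key]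
  refine exists_sign_change_quadratic hu.2 ?_ ?_ <;> rw [← key]
  · rw [h.out_one_div]
    have h1 : 0 < 1 - 2 * (1 / N) := by
      have : 2 / N < 1 := by rw [div_lt_one] <;> linarith [h.three_le]
      have e : 2 / N = 2 * (1 / N) := by ring
      linarith
    have h2 := mul_pos (mul_pos h1 (mul_pos hu.1 (sub_pos.2 hu.2))) (sub_pos.2 h.c_lt_one)
    nlinarith
  · have hm := h.out_mem (x := 1) ⟨zero_le_one, le_rfl⟩
    nlinarith [mul_pos hm.1 (sub_pos.2 hm.2)]

/-- The slope `dV/dD` of the curve `(D, V) = (spikeDiv N a, spikeDiv N (α + c a))`. -/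
noncomputable def slope (N α c a : ℝ) : ℝ := c * logOdds N (α + c * a) / logOdds N a

theorem slope_pos (h : HammingParam N α c) {a : ℝ} (ha : a ∈ Ioo (1 / N) 1) :
    0 < slope N α c a :=
  div_pos (h.c_mul_logOdds_pos ⟨ha.1, ha.2.le⟩) (logOdds_pos h.one_lt ha)

theorem exists_slope_deriv_sign_change (h : HammingParam N α c) : ∃ m ∈ Ioo (1 / N) 1,
    (∀ x ∈ Ioo (1 / N) m, 0 < c ^ 2 * (x * (1 - x) * logOdds N x) /
      ((α + c * x) * (1 - (α + c * x))) - c * logOdds N (α + c * x)) ∧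
    (∀ x ∈ Ioo m 1, c ^ 2 * (x * (1 - x) * logOdds N x) /
      ((α + c * x) * (1 - (α + c * x))) - c * logOdds N (α + c * x) < 0) := by
  obtain ⟨m, hm, hpos, hneg⟩ := h.exists_quadratic_sign_change
  have hu := one_div_mem_Ioo h.one_lt
  have hq : ∀ x ∈ Icc (1 / N) 1, 0 < (α + c * x) * (1 - (α + c * x)) := fun x hx => by
    have := h.out_mem (x := x) ⟨hu.1.le.trans hx.1, hx.2⟩
    exact mul_pos this.1 (sub_pos.2 this.2)
  set F : ℝ → ℝ := fun x => c ^ 2 * (x * (1 - x) * logOdds N x) /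
      ((α + c * x) * (1 - (α + c * x))) - c * logOdds N (α + c * x) with hF
  have hcont : ContinuousOn F (Icc (1 / N) 1) := by
    refine ContinuousOn.sub (ContinuousOn.div (continuousOn_const.mul
      ((continuousOn_mul_logOdds h.one_lt).mono (Icc_subset_Icc_left hu.1.le)))
      (by fun_prop) fun x hx => (hq x hx).ne') (continuousOn_const.mul ?_)
    intro x hx
    have hx' := h.out_mem (x := x) ⟨hu.1.le.trans hx.1, hx.2⟩
    exact (ContinuousAt.comp (f := fun x => α + c * x)
      (hasDerivAt_logOdds h.one_lt hx').continuousAt (by fun_prop)).continuousWithinAt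
  have hF1 : F 1 < 0 := by
    have := h.c_mul_logOdds_pos (a := 1) ⟨hu.2, le_rfl⟩
    simp only [hF]
    simp only [sub_self, mul_zero, zero_mul, zero_div, zero_sub]
    linarith
  set F' : ℝ → ℝ := fun x => c ^ 2 * logOdds N x *
    ((1 - 2 * x) * ((α + c * x) * (1 - (α + c * x)))
      - c * (1 - 2 * (α + c * x)) * (x * (1 - x))) / ((α + c * x) * (1 - (α + c * x))) ^ 2 with hF'
  have hl : F (1 / N) = 0 := by
    simp [hF, -one_div, h.out_one_div, logOdds_one_div h.one_lt]
  have hd : ∀ x ∈ Ioo (1 / N) 1, HasDerivAt F (F' x) x := by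
    intro x hx
    have hx0 : x ∈ Ioo (0 : ℝ) 1 := ⟨hu.1.trans hx.1, hx.2⟩
    have hA := h.out_mem (x := x) ⟨hx0.1.le, hx0.2.le⟩
    have d1 : HasDerivAt (fun x : ℝ => x * (1 - x)) (1 - 2 * x) x :=
      ((hasDerivAt_id x).mul ((hasDerivAt_id x).const_sub 1)).congr_deriv (by simp; ring)
    have d2 := (d1.mul (hasDerivAt_logOdds h.one_lt hx0)).const_mul (c ^ 2)
    have d3 : HasDerivAt (fun x : ℝ => (α + c * x) * (1 - (α + c * x)))
        (c * (1 - 2 * (α + c * x))) x :=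
      ((hasDerivAt_out x).mul ((hasDerivAt_out x).const_sub 1)).congr_deriv (by ring)
    have d4 := ((hasDerivAt_logOdds h.one_lt hA).comp x (hasDerivAt_out x)).const_mul c
    refine ((d2.div d3 (hq x ⟨hx.1.le, hx.2.le⟩).ne').sub d4).congr_deriv ?_
    have n1 := hx0.1.ne'
    have n2 := (sub_pos.2 hx0.2).ne'
    have n3 := hA.1.ne'
    have n4 := (sub_pos.2 hA.2).ne'
    simp only [Pi.mul_apply, hF']
    generalize α + c * x = A at *
    field_simp
    ring
  have hc2 : 0 < c ^ 2 := by have := h.ne_zero; positivity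
  have hF'pos : ∀ x ∈ Ioo (1 / N) m, 0 < F' x := fun x hx => by
    have hx1 : x ∈ Ioo (1 / N) 1 := ⟨hx.1, hx.2.trans hm.2⟩
    exact div_pos (mul_pos (mul_pos hc2 (logOdds_pos h.one_lt hx1)) (hpos x hx))
      (pow_pos (hq x ⟨hx1.1.le, hx1.2.le⟩) 2)
  have hF'neg : ∀ x ∈ Ioo m 1, F' x < 0 := fun x hx => by
    have hx1 : x ∈ Ioo (1 / N) 1 := ⟨hm.1.trans hx.1, hx.2⟩
    exact div_neg_of_neg_of_pos (mul_neg_of_pos_of_neg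
      (mul_pos hc2 (logOdds_pos h.one_lt hx1)) (hneg x hx))
      (pow_pos (hq x ⟨hx1.1.le, hx1.2.le⟩) 2)
  have hend : ∃ x ∈ Ioo (1 / N) 1, F x < 0 := by
    have : ContinuousWithinAt F (Ioo (1 / N) 1) 1 :=
      (hcont 1 ⟨hu.2.le, le_rfl⟩).mono Ioo_subset_Icc_self
    have hne : (𝓝[Ioo (1 / N) 1] (1 : ℝ)).NeBot := by
      rw [nhdsWithin_Ioo_eq_nhdsLT hu.2]; infer_instance
    have hev := (this.eventually (gt_mem_nhds hF1)).and self_mem_nhdsWithin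
    obtain ⟨x, hx, hx'⟩ := hev.exists
    exact ⟨x, hx', hx⟩
  obtain ⟨k, hk, -, h1, h2⟩ := exists_sign_change_of_deriv hm
    (hcont.mono Ico_subset_Icc_self) hl hd hF'pos hF'neg hend
  exact ⟨k, ⟨hm.1.trans hk.1, hk.2⟩, h1, h2⟩

/-- The derivative of `slope N α c`. -/
noncomputable def slopeDeriv (N α c x : ℝ) : ℝ :=
  (c ^ 2 * (x * (1 - x) * logOdds N x) / ((α + c * x) * (1 - (α + c * x)))
    - c * logOdds N (α + c * x)) / (x * (1 - x) * logOdds N x ^ 2)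

theorem hasDerivAt_slope (h : HammingParam N α c) {x : ℝ} (hx : x ∈ Ioo (1 / N) 1) :
    HasDerivAt (slope N α c) (slopeDeriv N α c x) x := by
  have hx0 : x ∈ Ioo (0 : ℝ) 1 := ⟨(one_div_mem_Ioo h.one_lt).1.trans hx.1, hx.2⟩
  have hA := h.out_mem (x := x) ⟨hx0.1.le, hx0.2.le⟩
  have d4 := ((hasDerivAt_logOdds h.one_lt hA).comp x (hasDerivAt_out x)).const_mul c
  have hl := (logOdds_pos h.one_lt hx).ne'
  refine (d4.div (hasDerivAt_logOdds h.one_lt hx0) hl).congr_deriv ?_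
  have n1 := hx0.1.ne'
  have n2 := (sub_pos.2 hx0.2).ne'
  have n3 := hA.1.ne'
  have n4 := (sub_pos.2 hA.2).ne'
  simp only [Function.comp, slopeDeriv]
  generalize α + c * x = A at *
  field_simp

theorem exists_slope_unimodal (h : HammingParam N α c) : ∃ m ∈ Ioo (1 / N) 1,
    (∀ x ∈ Ioo (1 / N) m, 0 < slopeDeriv N α c x) ∧ (∀ x ∈ Ioo m 1, slopeDeriv N α c x < 0) ∧
    StrictMonoOn (slope N α c) (Ioc (1 / N) m) ∧ StrictAntiOn (slope N α c) (Ico m 1) := by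
  obtain ⟨m, hm, hpos, hneg⟩ := h.exists_slope_deriv_sign_change
  have hu := one_div_mem_Ioo h.one_lt
  have hq : ∀ x ∈ Ioo (1 / N) 1, 0 < x * (1 - x) * logOdds N x ^ 2 := fun x hx =>
    mul_pos (mul_pos (hu.1.trans hx.1) (sub_pos.2 hx.2)) (pow_pos (logOdds_pos h.one_lt hx) 2)
  have hp : ∀ x ∈ Ioo (1 / N) m, 0 < slopeDeriv N α c x := fun x hx =>
    div_pos (hpos x hx) (hq x ⟨hx.1, hx.2.trans hm.2⟩)
  have hn : ∀ x ∈ Ioo m 1, slopeDeriv N α c x < 0 := fun x hx =>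
    div_neg_of_neg_of_pos (hneg x hx) (hq x ⟨hm.1.trans hx.1, hx.2⟩)
  refine ⟨m, hm, hp, hn, strictMonoOn_of_hasDerivAt_pos (convex_Ioc _ _) (fun x hx => ?_)
    (fun x hx => h.hasDerivAt_slope ?_) (fun x hx => hp x (by rwa [interior_Ioc] at hx)),
    strictAntiOn_of_hasDerivAt_neg (convex_Ico _ _) (fun x hx => ?_)
    (fun x hx => h.hasDerivAt_slope ?_) (fun x hx => hn x (by rwa [interior_Ico] at hx))⟩
  · exact (h.hasDerivAt_slope ⟨hx.1, hx.2.trans_lt hm.2⟩).continuousAt.continuousWithinAt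
  · rw [interior_Ioc] at hx; exact ⟨hx.1, hx.2.trans hm.2⟩
  · exact (h.hasDerivAt_slope ⟨hm.1.trans_le hx.1, hx.2⟩).continuousAt.continuousWithinAt
  · rw [interior_Ico] at hx; exact ⟨hm.1.trans hx.1, hx.2⟩

/-- There is exactly one point of the curve `(D, V) = (spikeDiv N a, spikeDiv N (α + c a))` whose
tangent passes through the origin, and from this point on every tangent lies above the curve. -/
theorem exists_tangent (h : HammingParam N α c) : ∃ k ∈ Ioo (1 / N) 1,
    slope N α c k = spikeDiv N (α + c * k) / spikeDiv N k ∧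
    (∀ a ∈ Ioo (1 / N) 1, slope N α c a = spikeDiv N (α + c * a) / spikeDiv N a → a = k) ∧
    ∀ b ∈ Ico k 1, ∀ a ∈ Icc (1 / N) 1,
      spikeDiv N (α + c * a) ≤
        spikeDiv N (α + c * b) + slope N α c b * (spikeDiv N a - spikeDiv N b) := by
  obtain ⟨m, hm, hpos, hneg, hmono, hanti⟩ := h.exists_slope_unimodal
  have hu := one_div_mem_Ioo h.one_lt
  have h01 : ∀ x ∈ Ioo (1 / N) 1, x ∈ Ioo (0 : ℝ) 1 := fun x hx => ⟨hu.1.trans hx.1, hx.2⟩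
  set F : ℝ → ℝ := fun a => slope N α c a * spikeDiv N a - spikeDiv N (α + c * a) with hF
  have hFd : ∀ x ∈ Ioo (1 / N) 1, HasDerivAt F (slopeDeriv N α c x * spikeDiv N x) x :=
    fun x hx => by
    refine (((h.hasDerivAt_slope hx).mul (hasDerivAt_spikeDiv h.one_lt (h01 x hx))).sub
      (h.hasDerivAt_outDiv (h01 x hx))).congr_deriv ?_
    have := (logOdds_pos h.one_lt hx).ne'
    simp only [slope]
    field_simp
    ring
  have hFl : F (1 / N) = 0 := by
    simp only [hF, spikeDiv_one_div h.one_lt, h.outDiv_one_div, mul_zero, sub_zero]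
  have hDpos : ∀ x ∈ Ioo (1 / N) 1, 0 < spikeDiv N x := fun x hx =>
    spikeDiv_pos h.one_lt ⟨hx.1, hx.2.le⟩
  have hcont : ContinuousOn F (Ico (1 / N) 1) := by
    intro x hx
    rcases hx.1.eq_or_lt with rfl | hx1
    · have hlim : Tendsto (fun a => slope N α c a * spikeDiv N a) (𝓝[Ico (1 / N) 1] (1 / N))
          (𝓝 0) := by
        have hD : Tendsto (fun a => slope N α c m * spikeDiv N a) (𝓝[Ico (1 / N) 1] (1 / N))
            (𝓝 0) := by
          have := ((continuous_spikeDiv N).tendsto (1 / N)).const_mul (slope N α c m)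
          rw [spikeDiv_one_div h.one_lt, mul_zero] at this
          exact this.mono_left nhdsWithin_le_nhds
        have hev : ∀ᶠ a in 𝓝[Ico (1 / N) 1] (1 / N), a ∈ Ico (1 / N) m := by
          filter_upwards [self_mem_nhdsWithin, nhdsWithin_le_nhds (Iio_mem_nhds hm.1)] with a h1 h2
          exact ⟨h1.1, h2⟩
        refine tendsto_of_tendsto_of_tendsto_of_le_of_le' tendsto_const_nhds hD ?_ ?_ <;>
          filter_upwards [hev] with a ha <;> rcases ha.1.eq_or_lt with rfl | ha1
        · simp [-one_div, spikeDiv_one_div h.one_lt]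
        · have ha' : a ∈ Ioo (1 / N) 1 := ⟨ha1, ha.2.trans hm.2⟩
          exact mul_nonneg (h.slope_pos ha').le (hDpos a ha').le
        · simp [-one_div, spikeDiv_one_div h.one_lt]
        · have ha' : a ∈ Ioo (1 / N) 1 := ⟨ha1, ha.2.trans hm.2⟩
          exact mul_le_mul_of_nonneg_right
            (hmono ⟨ha1, ha.2.le⟩ ⟨hm.1, le_rfl⟩ ha.2).le (hDpos a ha').le
      have h2 : Tendsto (fun a => spikeDiv N (α + c * a)) (𝓝[Ico (1 / N) 1] (1 / N)) (𝓝 0) := by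
        have := (continuous_outDiv (N := N) (α := α) (c := c)).tendsto (1 / N)
        rw [h.outDiv_one_div] at this
        exact this.mono_left nhdsWithin_le_nhds
      have h3 := hlim.sub h2
      rw [sub_zero] at h3
      rw [ContinuousWithinAt, hFl]
      exact h3
    · exact (hFd x ⟨hx1, hx.2⟩).continuousAt.continuousWithinAt
  have hend : ∃ x ∈ Ioo (1 / N) 1, F x < 0 := by
    have hne : (𝓝[<] (1 : ℝ)).NeBot := inferInstance
    have hA := h.out_mem (x := 1) ⟨zero_le_one, le_rfl⟩
    have h1 : Tendsto (fun x => c * logOdds N (α + c * x)) (𝓝[<] 1)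
        (𝓝 (c * logOdds N (α + c * 1))) := by
      have : ContinuousAt (fun x => logOdds N (α + c * x)) 1 :=
        ContinuousAt.comp (f := fun x => α + c * x)
          (hasDerivAt_logOdds h.one_lt hA).continuousAt (by fun_prop)
      exact (this.tendsto.const_mul c).mono_left nhdsWithin_le_nhds
    have h2 : Tendsto (slope N α c) (𝓝[<] 1) (𝓝 0) := h1.div_atTop (tendsto_logOdds_one h.one_lt)
    have h3 : Tendsto F (𝓝[<] 1) (𝓝 (0 * spikeDiv N 1 - spikeDiv N (α + c * 1))) :=
      (h2.mul (((continuous_spikeDiv N).tendsto 1).mono_left nhdsWithin_le_nhds)).sub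
        ((continuous_outDiv.tendsto 1).mono_left nhdsWithin_le_nhds)
    have h4 : 0 < spikeDiv N (α + c * 1) := by
      rw [← h.outDiv_one_div]
      exact h.strictMonoOn_outDiv ⟨le_rfl, hu.2.le⟩ ⟨hu.2.le, le_rfl⟩ hu.2
    have h5 : 0 * spikeDiv N 1 - spikeDiv N (α + c * 1) < 0 := by linarith
    have hev := (h3.eventually (gt_mem_nhds h5)).and
      (Ioo_mem_nhdsLT hu.2)
    obtain ⟨x, hx, hx'⟩ := hev.exists
    exact ⟨x, hx', hx⟩
  obtain ⟨k, hk, hFk, hFpos, hFneg⟩ := exists_sign_change_of_deriv hm hcont hFl hFd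
    (fun x hx => mul_pos (hpos x hx) (hDpos x ⟨hx.1, hx.2.trans hm.2⟩))
    (fun x hx => mul_neg_of_neg_of_pos (hneg x hx) (hDpos x ⟨hm.1.trans hx.1, hx.2⟩)) hend
  have hk' : k ∈ Ioo (1 / N) 1 := ⟨hm.1.trans hk.1, hk.2⟩
  refine ⟨k, hk', ?_, fun a ha hs => ?_, fun b hb a ha => ?_⟩
  · rw [eq_div_iff (hDpos k hk').ne']
    exact sub_eq_zero.1 hFk
  · rw [eq_div_iff (hDpos a ha).ne'] at hs
    have hFa : F a = 0 := sub_eq_zero.2 hs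
    rcases lt_trichotomy a k with h1 | h1 | h1
    · exact absurd hFa (hFpos a ⟨ha.1, h1⟩).ne'
    · exact h1
    · exact absurd hFa (hFneg a ⟨h1, ha.2⟩).ne
  · have hmb : m < b := hk.1.trans_le hb.1
    have hFb : F b ≤ 0 := by
      rcases hb.1.eq_or_lt with rfl | h1
      · exact hFk.le
      · exact (hFneg b ⟨h1, hb.2⟩).le
    set J : ℝ → ℝ := fun a => spikeDiv N (α + c * a) - slope N α c b * spikeDiv N a with hJ
    suffices hs : J a ≤ J b by simp only [hJ] at hs; linarith
    have hJc : Continuous J := continuous_outDiv.sub (continuous_const.mul (continuous_spikeDiv N))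
    have hJd : ∀ x ∈ Ioo (1 / N) 1,
        HasDerivAt J (logOdds N x * (slope N α c x - slope N α c b)) x := fun x hx => by
      refine ((h.hasDerivAt_outDiv (h01 x hx)).sub
        ((hasDerivAt_spikeDiv h.one_lt (h01 x hx)).const_mul _)).congr_deriv ?_
      have := (logOdds_pos h.one_lt hx).ne'
      simp only [slope]
      field_simp
    have hinc : ∀ x y, 1 / N ≤ x → x ≤ y → y ≤ 1 →
        (∀ z ∈ Ioo x y, slope N α c b ≤ slope N α c z) → J x ≤ J y := by
      intro x y hx hxy hy hz
      refine monotoneOn_of_deriv_nonneg (convex_Icc x y) hJc.continuousOn ?_ ?_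
        ⟨le_rfl, hxy⟩ ⟨hxy, le_rfl⟩ hxy <;> rw [interior_Icc]
      · exact fun z hz => (hJd z ⟨hx.trans_lt hz.1, hz.2.trans_le hy⟩).differentiableAt.differentiableWithinAt
      · intro z hzz
        have hz1 : z ∈ Ioo (1 / N) 1 := ⟨hx.trans_lt hzz.1, hzz.2.trans_le hy⟩
        rw [(hJd z hz1).deriv]
        exact mul_nonneg (logOdds_pos h.one_lt hz1).le (sub_nonneg.2 (hz z hzz))
    have hdec : ∀ x y, 1 / N ≤ x → x ≤ y → y ≤ 1 →
        (∀ z ∈ Ioo x y, slope N α c z ≤ slope N α c b) → J y ≤ J x := by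
      intro x y hx hxy hy hz
      refine antitoneOn_of_deriv_nonpos (convex_Icc x y) hJc.continuousOn ?_ ?_
        ⟨le_rfl, hxy⟩ ⟨hxy, le_rfl⟩ hxy <;> rw [interior_Icc]
      · exact fun z hz => (hJd z ⟨hx.trans_lt hz.1, hz.2.trans_le hy⟩).differentiableAt.differentiableWithinAt
      · intro z hzz
        have hz1 : z ∈ Ioo (1 / N) 1 := ⟨hx.trans_lt hzz.1, hzz.2.trans_le hy⟩
        rw [(hJd z hz1).deriv]
        exact mul_nonpos_of_nonneg_of_nonpos (logOdds_pos h.one_lt hz1).le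
          (sub_nonpos.2 (hz z hzz))
    have hleft : ∀ x ∈ Icc m b, J x ≤ J b := fun x hx =>
      hinc x b (hm.1.le.trans hx.1) hx.2 hb.2.le fun z hz =>
        (hanti ⟨hx.1.trans hz.1.le, hz.2.trans hb.2⟩ ⟨hmb.le, hb.2⟩ hz.2).le
    rcases le_total b a with hba | hab
    · exact hdec b a (hm.1.trans hmb).le hba ha.2 fun z hz =>
        (hanti ⟨hmb.le, hb.2⟩ ⟨(hmb.trans hz.1).le, hz.2.trans_le ha.2⟩ hz.1).le
    rcases le_total m a with hma | ham
    · exact hleft a ⟨hma, hab⟩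
    rcases ha.1.eq_or_lt with rfl | ha1
    · simp only [hJ, h.outDiv_one_div, spikeDiv_one_div h.one_lt]
      simp only [hF] at hFb
      linarith
    rcases le_total (slope N α c b) (slope N α c a) with hs | hs
    · refine (hinc a m ha.1 ham hm.2.le fun z hz => ?_).trans (hleft m ⟨le_rfl, hmb.le⟩)
      exact hs.trans (hmono ⟨ha1, ham⟩ ⟨ha1.trans hz.1, hz.2.le⟩ hz.1).le
    · refine (hdec (1 / N) a le_rfl ha.1 ha.2 fun z hz => ?_).trans ?_
      · exact (hmono ⟨hz.1, hz.2.le.trans ham⟩ ⟨ha1, ham⟩ hz.2).le.trans hs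
      · simp only [hJ, h.outDiv_one_div, spikeDiv_one_div h.one_lt]
        simp only [hF] at hFb
        linarith

end HammingParam

theorem eventually_lt_of_hasDerivAt_pos {G : ℝ → ℝ} {G' : ℝ} (hG : HasDerivAt G G' 0)
    (h : 0 < G') : ∀ᶠ t in 𝓝[>] 0, G 0 < G t := by
  have h1 := (hasDerivAt_iff_tendsto_slope.1 hG).eventually (lt_mem_nhds h)
  have h2 : 𝓝[>] (0 : ℝ) ≤ 𝓝[≠] 0 := nhdsWithin_mono _ fun x hx => ne_of_gt hx
  filter_upwards [h2 h1, self_mem_nhdsWithin] with t ht ht0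
  have ht0 : 0 < t := ht0
  rw [slope_def_field, sub_zero] at ht
  exact sub_pos.1 ((div_pos_iff_of_pos_right ht0).1 ht)

theorem eventually_lt_of_second_deriv_pos {G G' : ℝ → ℝ} {G'' : ℝ}
    (hG : ∀ᶠ t in 𝓝 0, HasDerivAt G (G' t) t) (hG' : HasDerivAt G' G'' 0) (h0 : G' 0 = 0)
    (h : 0 < G'') : ∀ᶠ t in 𝓝[>] 0, G 0 < G t := by
  have h1 := eventually_lt_of_hasDerivAt_pos hG' h
  rw [h0] at h1
  obtain ⟨u, hu, hu'⟩ := mem_nhdsGT_iff_exists_Ioo_subset.1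
    (h1.and (hG.filter_mono nhdsWithin_le_nhds))
  filter_upwards [Ioo_mem_nhdsGT hu] with t ht
  refine strictMonoOn_of_hasDerivAt_pos (convex_Icc 0 t) (f' := G') ?_ ?_ ?_
    ⟨le_rfl, ht.1.le⟩ ⟨ht.1.le, le_rfl⟩ ht.1
  · intro s hs
    rcases hs.1.eq_or_lt with rfl | hs0
    · exact hG.self_of_nhds.continuousAt.continuousWithinAt
    · exact (hu' ⟨hs0, hs.2.trans_lt ht.2⟩).2.continuousAt.continuousWithinAt
  · rw [interior_Icc]; exact fun s hs => (hu' ⟨hs.1, hs.2.trans ht.2⟩).2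
  · rw [interior_Icc]; exact fun s hs => (hu' ⟨hs.1, hs.2.trans ht.2⟩).1

theorem hasDerivAt_sum_three_line {f : ℝ → ℝ} {x y z fx fy fz : ℝ} (hx : HasDerivAt f fx x)
    (hy : HasDerivAt f fy y) (hz : HasDerivAt f fz z) (d e : ℝ) :
    HasDerivAt (fun t => f (x + d * t) + f (y - (d + e) * t) + f (z + e * t))
      (d * (fx - fy) + e * (fz - fy)) 0 := by
  have h1 : HasDerivAt (fun t : ℝ => x + d * t) d 0 := by
    simpa using ((hasDerivAt_id (0 : ℝ)).const_mul d).const_add x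
  have h2 : HasDerivAt (fun t : ℝ => y - (d + e) * t) (-(d + e)) 0 := by
    simpa using ((hasDerivAt_id (0 : ℝ)).const_mul (d + e)).const_sub y
  have h3 : HasDerivAt (fun t : ℝ => z + e * t) e 0 := by
    simpa using ((hasDerivAt_id (0 : ℝ)).const_mul e).const_add z
  have k1 := HasDerivAt.comp (h := fun t : ℝ => x + d * t) (0 : ℝ) (by simpa using hx) h1
  have k2 := HasDerivAt.comp (h := fun t : ℝ => y - (d + e) * t) (0 : ℝ) (by simpa using hy) h2
  have k3 := HasDerivAt.comp (h := fun t : ℝ => z + e * t) (0 : ℝ) (by simpa using hz) h3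
  exact ((k1.add k2).add k3).congr_deriv (by ring)

/-- Along `t ↦ (x + κ t², y - t - κ t², y + t)` the sum of the values of `f` has vanishing first
and explicit second derivative at `0`. -/
theorem eventually_lt_sum_three_parabola {f f' : ℝ → ℝ} {x y fx fy κ : ℝ}
    (hx : ∀ᶠ w in 𝓝 x, HasDerivAt f (f' w) w) (hy : ∀ᶠ w in 𝓝 y, HasDerivAt f (f' w) w)
    (hx' : HasDerivAt f' fx x) (hy' : HasDerivAt f' fy y)
    (h : 0 < 2 * κ * (f' x - f' y) + 2 * fy) :
    ∀ᶠ t in 𝓝[>] 0, f x + f y + f y <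
      f (x + κ * t ^ 2) + f (y - t - κ * t ^ 2) + f (y + t) := by
  have d1 : ∀ t : ℝ, HasDerivAt (fun t : ℝ => x + κ * t ^ 2) (κ * (2 * t)) t := fun t => by
    simpa using ((hasDerivAt_pow 2 t).const_mul κ).const_add x
  have d2 : ∀ t : ℝ, HasDerivAt (fun t : ℝ => y - t - κ * t ^ 2) (-1 - κ * (2 * t)) t := fun t =>
    (((hasDerivAt_id' t).const_sub y).sub ((hasDerivAt_pow 2 t).const_mul κ)).congr_deriv (by simp)
  have d3 : ∀ t : ℝ, HasDerivAt (fun t : ℝ => y + t) 1 t := fun t => by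
    simpa using (hasDerivAt_id t).const_add y
  have c1 : Tendsto (fun t : ℝ => x + κ * t ^ 2) (𝓝 0) (𝓝 x) := by
    simpa using (d1 0).continuousAt.tendsto
  have c2 : Tendsto (fun t : ℝ => y - t - κ * t ^ 2) (𝓝 0) (𝓝 y) := by
    simpa using (d2 0).continuousAt.tendsto
  have c3 : Tendsto (fun t : ℝ => y + t) (𝓝 0) (𝓝 y) := by
    simpa using (d3 0).continuousAt.tendsto
  have key := eventually_lt_of_second_deriv_pos
    (G := fun t => f (x + κ * t ^ 2) + f (y - t - κ * t ^ 2) + f (y + t))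
    (G' := fun t => f' (x + κ * t ^ 2) * (κ * (2 * t)) +
      f' (y - t - κ * t ^ 2) * (-1 - κ * (2 * t)) + f' (y + t) * 1)
    (G'' := 2 * κ * (f' x - f' y) + 2 * fy) ?_ ?_ ?_ h
  · simpa using key
  · filter_upwards [c1.eventually hx, c2.eventually hy, c3.eventually hy] with t h1 h2 h3
    exact ((h1.comp t (d1 t)).add (h2.comp t (d2 t))).add (h3.comp t (d3 t))
  · have e1 : HasDerivAt (fun t : ℝ => κ * (2 * t)) (κ * 2) 0 := by
      simpa using (((hasDerivAt_id (0 : ℝ)).const_mul 2).const_mul κ)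
    have k1 := HasDerivAt.comp (h := fun t : ℝ => x + κ * t ^ 2) (0 : ℝ) (by simpa using hx') (d1 0)
    have k2 := HasDerivAt.comp (h := fun t : ℝ => y - t - κ * t ^ 2) (0 : ℝ)
      (by simpa using hy') (d2 0)
    have k3 := HasDerivAt.comp (h := fun t : ℝ => y + t) (0 : ℝ) (by simpa using hy') (d3 0)
    refine (((k1.mul e1).add (k2.mul (e1.const_sub (-1)))).add (k3.mul_const 1)).congr_deriv ?_
    simp
    ring
  · simp

namespace HammingParam

variable {N α c : ℝ}

theorem hasDerivAt_c_mul_log (h : HammingParam N α c) {x : ℝ} (hx : x ∈ Icc (0 : ℝ) 1) :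
    HasDerivAt (fun x => c * log (α + c * x)) (c ^ 2 / (α + c * x)) x := by
  refine (((hasDerivAt_out x).log (h.out_mem hx).1.ne').const_mul c).congr_deriv ?_
  ring

theorem hasDerivAt_negMulLog_out {x : ℝ} (hx : α + c * x ≠ 0) :
    HasDerivAt (fun x => -negMulLog (α + c * x)) (c * log (α + c * x) + c) x := by
  refine ((hasDerivAt_negMulLog hx).comp x (hasDerivAt_out x)).neg.congr_deriv ?_
  ring

/-- `c log (α + c x)` is a strictly convex function of `log x`: it lies above its tangents. -/
theorem tangent_lt (h : HammingParam N α c) {x y : ℝ} (hx : x ∈ Ioc (0 : ℝ) 1)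
    (hy : y ∈ Ioc (0 : ℝ) 1) (hxy : x ≠ y) :
    c ^ 2 * y / (α + c * y) * (log x - log y) <
      c * log (α + c * x) - c * log (α + c * y) := by
  have hA : ∀ t ∈ Ioc (0 : ℝ) 1, 0 < α + c * t := fun t ht => (h.out_mem ⟨ht.1.le, ht.2⟩).1
  set f : ℝ → ℝ := fun t => c * log (α + c * t) - c ^ 2 * y / (α + c * y) * log t with hf
  set f' : ℝ → ℝ := fun t => c ^ 2 * α * (t - y) / (t * (α + c * t) * (α + c * y)) with hf'
  have hd : ∀ t ∈ Ioc (0 : ℝ) 1, HasDerivAt f (f' t) t := fun t ht => by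
    refine ((h.hasDerivAt_c_mul_log ⟨ht.1.le, ht.2⟩).sub
      ((hasDerivAt_log ht.1.ne').const_mul _)).congr_deriv ?_
    have h1 := (hA t ht).ne'
    have h2 := (hA y hy).ne'
    have h3 := ht.1.ne'
    simp only [hf']
    rw [← sub_eq_zero]
    field_simp
    ring
  have hc2 : 0 < c ^ 2 * α := mul_pos (by have := h.ne_zero; positivity) h.pos
  have hden : ∀ t ∈ Ioc (0 : ℝ) 1, 0 < t * (α + c * t) * (α + c * y) := fun t ht =>
    mul_pos (mul_pos ht.1 (hA t ht)) (hA y hy)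
  suffices hs : f y < f x by simp only [hf] at hs; linarith
  rcases lt_or_gt_of_ne hxy with hlt | hlt
  · have hsub : ∀ t ∈ Icc x y, t ∈ Ioc (0 : ℝ) 1 := fun t ht =>
      ⟨hx.1.trans_le ht.1, ht.2.trans hy.2⟩
    refine strictAntiOn_of_hasDerivAt_neg (f' := f') (convex_Icc x y)
      (fun t ht => (hd t (hsub t ht)).continuousAt.continuousWithinAt)
      (fun t ht => hd t (hsub t (interior_subset ht))) (fun t ht => ?_)
      ⟨le_rfl, hlt.le⟩ ⟨hlt.le, le_rfl⟩ hlt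
    have h1 := hden t (hsub t (interior_subset ht))
    rw [interior_Icc] at ht
    exact div_neg_of_neg_of_pos (mul_neg_of_pos_of_neg hc2 (by linarith [ht.2])) h1
  · have hsub : ∀ t ∈ Icc y x, t ∈ Ioc (0 : ℝ) 1 := fun t ht =>
      ⟨hy.1.trans_le ht.1, ht.2.trans hx.2⟩
    refine strictMonoOn_of_hasDerivAt_pos (f' := f') (convex_Icc y x)
      (fun t ht => (hd t (hsub t ht)).continuousAt.continuousWithinAt)
      (fun t ht => hd t (hsub t (interior_subset ht))) (fun t ht => ?_)
      ⟨le_rfl, hlt.le⟩ ⟨hlt.le, le_rfl⟩ hlt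
    have h1 := hden t (hsub t (interior_subset ht))
    rw [interior_Icc] at ht
    exact div_pos (mul_pos hc2 (by linarith [ht.1])) h1

/-- Three probabilities `x < y ≤ z` can be changed, without decreasing the least one nor changing
the sum, such that the input entropy does not decrease and the output entropy decreases. -/
theorem exists_better_triple (h : HammingParam N α c) {x y z : ℝ} (hx : 0 < x) (hxy : x < y)
    (hyz : y ≤ z) (hz : z ≤ 1) : ∃ x' y' z', x ≤ x' ∧ x ≤ y' ∧ x ≤ z' ∧
      x' + y' + z' = x + y + z ∧
      negMulLog x + negMulLog y + negMulLog z ≤ negMulLog x' + negMulLog y' + negMulLog z' ∧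
      negMulLog (α + c * x') + negMulLog (α + c * y') + negMulLog (α + c * z') <
        negMulLog (α + c * x) + negMulLog (α + c * y) + negMulLog (α + c * z) := by
  have hy0 : 0 < y := hx.trans hxy
  have hz0 : 0 < z := hy0.trans_le hyz
  have hx1 : x ∈ Ioc (0 : ℝ) 1 := ⟨hx, hxy.le.trans (hyz.trans hz)⟩
  have hy1 : y ∈ Ioc (0 : ℝ) 1 := ⟨hy0, hyz.trans hz⟩
  have hz1 : z ∈ Ioc (0 : ℝ) 1 := ⟨hz0, hz⟩
  have hA : ∀ t ∈ Ioc (0 : ℝ) 1, 0 < α + c * t := fun t ht => (h.out_mem ⟨ht.1.le, ht.2⟩).1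
  have hp : 0 < log y - log x := sub_pos.2 (log_lt_log hx hxy)
  have t1 := h.tangent_lt hx1 hy1 hxy.ne
  set k := c ^ 2 * y / (α + c * y) with hk
  have hk0 : 0 < k := div_pos (mul_pos (by have := h.ne_zero; positivity) hy0) (hA y hy1)
  rcases hyz.eq_or_lt with rfl | hyz
  · obtain ⟨κ, hκ1, hκ2⟩ : ∃ κ, 1 / y < κ * (log y - log x) ∧
        κ * (c * log (α + c * y) - c * log (α + c * x)) < c ^ 2 / (α + c * y) := by
      set p := log y - log x
      set q := c * log (α + c * y) - c * log (α + c * x) with hq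
      have hqp : q < k * p := by simp only [hq, p]; linarith
      have hky : c ^ 2 / (α + c * y) = k * (1 / y) := by rw [hk]; field_simp
      rw [hky]
      have hy' : 0 < 1 / y := by positivity
      generalize 1 / y = r at hy'
      have hm : 0 < max q (k * p / 2) := lt_max_of_lt_right (by positivity)
      have hm2 : max q (k * p / 2) < k * p := max_lt hqp (by linarith [mul_pos hk0 hp])
      have hlt : r / p < k * r / max q (k * p / 2) := by
        rw [div_lt_div_iff₀ hp hm]; nlinarith
      obtain ⟨κ, h1, h2⟩ := exists_between hlt
      have hκ0 : 0 < κ := (div_pos hy' hp).trans h1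
      refine ⟨κ, (div_lt_iff₀ hp).1 h1, ?_⟩
      rw [lt_div_iff₀ hm] at h2
      exact (mul_le_mul_of_nonneg_left (le_max_left _ _) hκ0.le).trans_lt h2
    have hκ0 : 0 < κ := by
      by_contra hcon
      have : 0 < 1 / y := by positivity
      nlinarith
    have e1 := eventually_lt_sum_three_parabola (f := negMulLog) (f' := fun w => -log w - 1)
      (x := x) (y := y) (κ := κ)
      ((lt_mem_nhds hx).mono fun w hw => hasDerivAt_negMulLog hw.ne')
      ((lt_mem_nhds hy0).mono fun w hw => hasDerivAt_negMulLog hw.ne')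
      ((hasDerivAt_log hx.ne').neg.sub_const 1) ((hasDerivAt_log hy0.ne').neg.sub_const 1)
      (by rw [one_div] at hκ1; nlinarith)
    have hAc : Continuous fun w : ℝ => α + c * w := by fun_prop
    have e2 := eventually_lt_sum_three_parabola (f := fun w => -negMulLog (α + c * w))
      (f' := fun w => c * log (α + c * w) + c) (x := x) (y := y) (κ := κ)
      ((hAc.continuousAt.eventually (lt_mem_nhds (hA x hx1))).mono fun w hw =>
        hasDerivAt_negMulLog_out hw.ne')
      ((hAc.continuousAt.eventually (lt_mem_nhds (hA y hy1))).mono fun w hw =>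
        hasDerivAt_negMulLog_out hw.ne')
      ((h.hasDerivAt_c_mul_log ⟨hx1.1.le, hx1.2⟩).add_const c)
      ((h.hasDerivAt_c_mul_log ⟨hy1.1.le, hy1.2⟩).add_const c)
      (by nlinarith)
    have c2 : ContinuousAt (fun t : ℝ => y - t - κ * t ^ 2) 0 := by fun_prop
    have e3 : ∀ᶠ t in 𝓝[>] (0 : ℝ), x < y - t - κ * t ^ 2 :=
      (c2.eventually (lt_mem_nhds (by simpa using hxy))).filter_mono nhdsWithin_le_nhds
    obtain ⟨t, h1, h2, h3, ht⟩ :=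
      (e1.and (e2.and (e3.and (eventually_mem_nhdsWithin (s := Ioi (0 : ℝ)))))).exists
    have ht : 0 < t := ht
    exact ⟨x + κ * t ^ 2, y - t - κ * t ^ 2, y + t, by nlinarith [pow_pos ht 2], h3.le,
      by linarith, by ring, h1.le, by linarith⟩
  · have t2 := h.tangent_lt hz1 hy1 hyz.ne'
    rw [← hk] at t2
    have hq : 0 < log z - log y := sub_pos.2 (log_lt_log hy0 hyz)
    obtain ⟨d, e, hd, he, h1, h2⟩ : ∃ d e, 0 < d ∧ 0 < e ∧
        0 < d * (log y - log x) - e * (log z - log y) ∧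
        0 < d * (c * log (α + c * x) - c * log (α + c * y)) +
          e * (c * log (α + c * z) - c * log (α + c * y)) := by
      have t1' : -k * (log y - log x) < c * log (α + c * x) - c * log (α + c * y) := by linarith
      generalize log y - log x = p at *
      generalize log z - log y = q at *
      generalize c * log (α + c * x) - c * log (α + c * y) = u at *
      generalize c * log (α + c * z) - c * log (α + c * y) = v at *
      have hs : 0 < q * u + p * v := by nlinarith
      have hu : 0 < |u| + 1 := by positivity
      set ε := (q * u + p * v) / (|u| + 1) with hε
      have hε0 : 0 < ε := div_pos hs hu
      have hε1 : ε * (|u| + 1) = q * u + p * v := div_mul_cancel₀ _ hu.ne'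
      refine ⟨q + ε, p, by linarith, hp, by nlinarith, ?_⟩
      nlinarith [neg_abs_le u]
    have e1 := eventually_lt_of_hasDerivAt_pos (hasDerivAt_sum_three_line
      (hasDerivAt_negMulLog hx.ne') (hasDerivAt_negMulLog hy0.ne')
      (hasDerivAt_negMulLog hz0.ne') d e) (by linarith)
    have e2 := eventually_lt_of_hasDerivAt_pos (hasDerivAt_sum_three_line
      (hasDerivAt_negMulLog_out (hA x hx1).ne') (hasDerivAt_negMulLog_out (hA y hy1).ne')
      (hasDerivAt_negMulLog_out (hA z hz1).ne') d e) (by linarith)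
    simp only [mul_zero, add_zero, sub_zero] at e1 e2
    have c2 : ContinuousAt (fun t : ℝ => y - (d + e) * t) 0 := by fun_prop
    have e3 : ∀ᶠ t in 𝓝[>] (0 : ℝ), x < y - (d + e) * t :=
      (c2.eventually (lt_mem_nhds (by simpa using hxy))).filter_mono nhdsWithin_le_nhds
    obtain ⟨t, h1, h2, h3, ht⟩ :=
      (e1.and (e2.and (e3.and (eventually_mem_nhdsWithin (s := Ioi (0 : ℝ)))))).exists
    have ht : 0 < t := ht
    exact ⟨x + d * t, y - (d + e) * t, z + e * t, by nlinarith, h3.le, by nlinarith, by ring,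
      h1.le, by linarith⟩

end HammingParam

theorem continuous_entropy {A : Type*} [Fintype A] : Continuous (entropy : (A → ℝ) → ℝ) :=
  continuous_finsetSum _ fun a _ => continuous_negMulLog.comp (continuous_apply a)

section Entropy

variable {X : Type*} [Fintype X]

theorem entropy_nonneg {p : X → ℝ} (hp : p ∈ stdSimplex ℝ X) : 0 ≤ entropy p :=
  Finset.sum_nonneg fun x _ => negMulLog_nonneg (hp.1 x) (by
    rw [← hp.2]; exact Finset.single_le_sum (fun x _ => hp.1 x) (Finset.mem_univ x))

theorem sum_uniformLaw [Nonempty X] : ∑ x, uniformLaw X x = 1 := by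
  simp [uniformLaw]

theorem entropy_uniformLaw [Nonempty X] :
    entropy (uniformLaw X) = log (Fintype.card X) := by
  simp [entropy, uniformLaw, negMulLog]

theorem uniformLaw_mem_stdSimplex [Nonempty X] : uniformLaw X ∈ stdSimplex ℝ X :=
  ⟨fun _ => by unfold uniformLaw; positivity, sum_uniformLaw⟩

theorem entropy_le_log_card [Nonempty X] {p : X → ℝ} (hp : p ∈ stdSimplex ℝ X) :
    entropy p ≤ log (Fintype.card X) := by
  have hX : (0 : ℝ) < Fintype.card X := by exact_mod_cast Fintype.card_pos
  have key : ∀ x, negMulLog (p x) ≤ 1 / (Fintype.card X : ℝ) - p x + p x * log (Fintype.card X) :=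
    fun x => by
    rcases (hp.1 x).eq_or_lt with h0 | h0
    · rw [← h0]; simp
    · have h1 := log_le_sub_one_of_pos (x := 1 / (Fintype.card X * p x)) (by positivity)
      rw [one_div, log_inv, log_mul hX.ne' h0.ne'] at h1
      have h2 := mul_le_mul_of_nonneg_left h1 h0.le
      have h3 : p x * ((Fintype.card X * p x)⁻¹ - 1) = 1 / (Fintype.card X : ℝ) - p x := by
        field_simp
      rw [negMulLog]
      linarith
  refine (Finset.sum_le_sum fun x _ => key x).trans_eq ?_
  rw [Finset.sum_add_distrib, Finset.sum_sub_distrib, ← Finset.sum_mul, hp.2]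
  simp

end Entropy

section Spike

variable {X : Type*} [Fintype X] [DecidableEq X]

/-- The law with mass `a` at `i` and equal masses at all other points. -/
noncomputable def spike (i : X) (a : ℝ) : X → ℝ :=
  fun x => if x = i then a else (1 - a) / ((Fintype.card X : ℝ) - 1)

theorem sum_spike (i : X) (a : ℝ) (F : ℝ → ℝ) :
    ∑ x, F (spike i a x) =
      F a + ((Fintype.card X : ℝ) - 1) * F ((1 - a) / ((Fintype.card X : ℝ) - 1)) := by
  have hcard : 1 ≤ Fintype.card X := Fintype.card_pos_iff.2 ⟨i⟩
  rw [← Finset.add_sum_erase _ _ (Finset.mem_univ i)]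
  congr 1
  · simp [spike]
  · rw [Finset.sum_congr rfl (g := fun _ => F ((1 - a) / ((Fintype.card X : ℝ) - 1)))
      fun x hx => by rw [spike, if_neg (Finset.ne_of_mem_erase hx)]]
    rw [Finset.sum_const, Finset.card_erase_of_mem (Finset.mem_univ i), Finset.card_univ,
      nsmul_eq_mul, Nat.cast_sub hcard, Nat.cast_one]

theorem spikeDiv_eq (i : X) (a : ℝ) :
    log (Fintype.card X) - entropy (spike i a) = spikeDiv (Fintype.card X) a := by
  rw [entropy, sum_spike, spikeDiv]
  ring

theorem spike_mem_stdSimplex (hX : (1 : ℝ) < Fintype.card X) (i : X) {a : ℝ}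
    (ha : a ∈ Icc (0 : ℝ) 1) : spike i a ∈ stdSimplex ℝ X := by
  have hX' : (0 : ℝ) < Fintype.card X - 1 := by linarith
  refine ⟨fun x => ?_, ?_⟩
  · unfold spike
    split_ifs
    · exact ha.1
    · exact div_nonneg (by linarith [ha.2]) hX'.le
  · have := sum_spike i a id
    simp only [id] at this
    rw [this]
    field_simp
    ring

variable {α c : ℝ}

theorem outputLaw_hammingChannel (h : (Fintype.card X : ℝ) * α + c = 1) {p : X → ℝ}
    (hp : ∑ x, p x = 1) (y : X) : outputLaw p (hammingChannel X α) y = α + c * p y := by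
  have e : ∀ x, p x * hammingChannel X α x y = p x * α + if x = y then p x * c else 0 :=
    fun x => by
      unfold hammingChannel
      split_ifs
      · linear_combination (-p x) * h
      · ring
  simp only [outputLaw, e, Finset.sum_add_distrib, ← Finset.sum_mul, hp,
    Finset.sum_ite_eq', Finset.mem_univ, if_true]
  ring

theorem out_spike (h : HammingParam (Fintype.card X) α c) (i : X) (a : ℝ) (x : X) :
    α + c * spike i a x = spike i (α + c * a) x := by
  have h1 : (Fintype.card X : ℝ) - 1 ≠ 0 := by linarith [h.three_le]
  unfold spike
  split_ifs
  · rfl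
  · field_simp
    linear_combination h.sum_eq

theorem entropy_outputLaw (h : (Fintype.card X : ℝ) * α + c = 1) {p : X → ℝ}
    (hp : ∑ x, p x = 1) :
    entropy (outputLaw p (hammingChannel X α)) = ∑ x, negMulLog (α + c * p x) :=
  Finset.sum_congr rfl fun x _ => by rw [outputLaw_hammingChannel h hp]

theorem outDiv_spike (h : HammingParam (Fintype.card X) α c) (i : X) {a : ℝ}
    (ha : a ∈ Icc (0 : ℝ) 1) :
    log (Fintype.card X) - entropy (outputLaw (spike i a) (hammingChannel X α)) =
      spikeDiv (Fintype.card X) (α + c * a) := by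
  rw [entropy_outputLaw h.sum_eq (spike_mem_stdSimplex h.one_lt i ha).2,
    ← spikeDiv_eq i (α + c * a), entropy]
  simp only [out_spike h]

theorem sum_update_three {i j k : X} (hij : i ≠ j) (hik : i ≠ k) (hjk : j ≠ k) (q : X → ℝ)
    (x y z : ℝ) (F : ℝ → ℝ) :
    ∑ w, F (Function.update (Function.update (Function.update q k z) j y) i x w) =
      ∑ w, F (q w) + (F x + F y + F z - (F (q i) + F (q j) + F (q k))) := by
  have key : ∀ g : X → ℝ, ∑ w, g w = g i + (g j + (g k +
      ∑ w ∈ ((Finset.univ.erase i).erase j).erase k, g w)) := fun g => by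
    rw [Finset.add_sum_erase _ _ (by simp [hik.symm, hjk.symm]),
      Finset.add_sum_erase _ _ (by simp [hij.symm]), Finset.add_sum_erase _ _ (Finset.mem_univ i)]
  rw [key, key fun w => F (q w)]
  have : ∑ w ∈ ((Finset.univ.erase i).erase j).erase k,
      F (Function.update (Function.update (Function.update q k z) j y) i x w) =
      ∑ w ∈ ((Finset.univ.erase i).erase j).erase k, F (q w) := by
    refine Finset.sum_congr rfl fun w hw => ?_
    simp only [Finset.mem_erase, Finset.mem_univ, and_true] at hw
    simp [Function.update_of_ne, hw.1, hw.2.1, hw.2.2]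
  rw [this]
  simp only [Function.update_self, Function.update_of_ne hij.symm, Function.update_of_ne hik.symm,
    Function.update_of_ne hjk.symm]
  ring

/-- A law whose masses are equal except for a largest one is a spike. -/
theorem exists_eq_spike (hX : (1 : ℝ) < Fintype.card X) {q : X → ℝ} (hq : q ∈ stdSimplex ℝ X)
    {k : X} (hk : ∀ x, q x ≤ q k) (heq : ∀ i j, i ≠ k → j ≠ k → q i = q j) :
    ∃ a ∈ Icc (1 / (Fintype.card X : ℝ)) 1, q = spike k a := by
  have hX0 : (0 : ℝ) < Fintype.card X := by linarith
  have hX' : (0 : ℝ) < Fintype.card X - 1 := by linarith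
  refine ⟨q k, ⟨?_, ?_⟩, funext fun x => ?_⟩
  · rw [div_le_iff₀ hX0, ← hq.2]
    refine (Finset.sum_le_sum fun x _ => hk x).trans ?_
    rw [Finset.sum_const, Finset.card_univ, nsmul_eq_mul, mul_comm]
  · rw [← hq.2]
    exact Finset.single_le_sum (fun x _ => hq.1 x) (Finset.mem_univ k)
  · unfold spike
    split_ifs with hx
    · rw [hx]
    · have hcard : 1 ≤ Fintype.card X := Fintype.card_pos_iff.2 ⟨k⟩
      have h1 := hq.2
      rw [← Finset.add_sum_erase _ _ (Finset.mem_univ k), Finset.sum_congr rfl (g := fun _ => q x)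
        fun y hy => heq y x (Finset.ne_of_mem_erase hy) hx, Finset.sum_const,
        Finset.card_erase_of_mem (Finset.mem_univ k), Finset.card_univ, nsmul_eq_mul,
        Nat.cast_sub hcard, Nat.cast_one] at h1
      rw [eq_div_iff hX'.ne']
      linarith

theorem exists_spike_of_pos (h : HammingParam (Fintype.card X) α c) {p : X → ℝ}
    (hp : p ∈ stdSimplex ℝ X) (hpos : ∀ x, 0 < p x) :
    ∃ a ∈ Icc (1 / (Fintype.card X : ℝ)) 1,
      spikeDiv (Fintype.card X) a ≤ log (Fintype.card X) - entropy p ∧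
      log (Fintype.card X) - ∑ x, negMulLog (α + c * p x) ≤
        spikeDiv (Fintype.card X) (α + c * a) := by
  have hne : Nonempty X := by
    have := h.one_lt
    exact Fintype.card_pos_iff.1 (by exact_mod_cast (by linarith : (0 : ℝ) < Fintype.card X))
  obtain ⟨i₀, hi₀⟩ := Finite.exists_min p
  set S : Set (X → ℝ) := stdSimplex ℝ X ∩ {q | (∀ x, p i₀ ≤ q x) ∧ entropy p ≤ entropy q} with hS
  have hSc : IsCompact S := by
    refine (isCompact_stdSimplex ℝ X).inter_right (IsClosed.inter ?_ ?_)
    · exact isClosed_Ici (a := fun _ : X => p i₀)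
    · exact isClosed_le continuous_const continuous_entropy
  have hg : Continuous fun q : X → ℝ => ∑ x, negMulLog (α + c * q x) := by
    have := continuous_negMulLog
    fun_prop
  obtain ⟨q, ⟨hq, hqε, hqe⟩, hmin⟩ := hSc.exists_isMinOn ⟨p, hp, hi₀, le_rfl⟩ hg.continuousOn
  have hq1 : ∀ x, q x ≤ 1 := fun x => by
    rw [← hq.2]
    exact Finset.single_le_sum (fun x _ => hq.1 x) (Finset.mem_univ x)
  obtain ⟨k, hk⟩ := Finite.exists_max q
  have hno : ∀ i j, i ≠ k → j ≠ k → ¬ q i < q j := by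
    intro i j hik hjk hij
    obtain ⟨x', y', z', hx, hy, hz, hsum, hent, hout⟩ :=
      h.exists_better_triple ((hpos i₀).trans_le (hqε i)) hij (hk j) (hq1 k)
    have hij' : i ≠ j := fun e => by rw [e] at hij; exact lt_irrefl _ hij
    set q' := Function.update (Function.update (Function.update q k z') j y') i x' with hq'
    have hs := fun F => sum_update_three hij' hik hjk q x' y' z' F
    rw [← hq'] at hs
    have hε' : ∀ w, p i₀ ≤ q' w := fun w => by
      simp only [hq', Function.update_apply]
      have := hqε i
      split_ifs
      · linarith
      · linarith
      · linarith
      · exact hqε w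
    have hmem : q' ∈ S := by
      refine ⟨⟨fun w => (hpos i₀).le.trans (hε' w), ?_⟩, hε', ?_⟩
      · have := hs id
        simp only [id] at this
        rw [this, hq.2]
        linarith
      · refine hqe.trans ?_
        rw [entropy, entropy, hs negMulLog]
        linarith
    have h1 : ∑ w, negMulLog (α + c * q w) ≤ ∑ w, negMulLog (α + c * q' w) := hmin hmem
    have h2 := hs fun w => negMulLog (α + c * w)
    linarith
  obtain ⟨a, ha, rfl⟩ := exists_eq_spike h.one_lt hq hk fun i j hi hj =>
    le_antisymm (not_lt.1 (hno j i hj hi)) (not_lt.1 (hno i j hi hj))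
  refine ⟨a, ha, ?_, ?_⟩
  · rw [← spikeDiv_eq k a]
    linarith
  · have h1 : ∑ x, negMulLog (α + c * spike k a x) ≤ ∑ x, negMulLog (α + c * p x) :=
      hmin ⟨hp, hi₀, le_rfl⟩
    rw [← spikeDiv_eq k (α + c * a), entropy]
    simp only [out_spike h] at h1
    linarith

/-- Among the laws with given entropy, a spike has the output law of least entropy. -/
theorem outDiv_le (h : HammingParam (Fintype.card X) α c) {p : X → ℝ} (hp : p ∈ stdSimplex ℝ X)
    {a : ℝ} (ha : a ∈ Icc (1 / (Fintype.card X : ℝ)) 1)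
    (hpa : log (Fintype.card X) - entropy p ≤ spikeDiv (Fintype.card X) a) :
    log (Fintype.card X) - entropy (outputLaw p (hammingChannel X α)) ≤
      spikeDiv (Fintype.card X) (α + c * a) := by
  have hX0 : (0 : ℝ) < Fintype.card X := by linarith [h.one_lt]
  have hne : Nonempty X := Fintype.card_pos_iff.1 (by exact_mod_cast hX0)
  rw [entropy_outputLaw h.sum_eq hp.2]
  set P : ℝ → X → ℝ := fun t x => (1 - t) * p x + t * uniformLaw X x with hP
  have hPc : Continuous fun t => log (Fintype.card X) - ∑ x, negMulLog (α + c * P t x) := by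
    have := continuous_negMulLog
    fun_prop
  have hlim : Tendsto (fun t => log (Fintype.card X) - ∑ x, negMulLog (α + c * P t x)) (𝓝[>] 0)
      (𝓝 (log (Fintype.card X) - ∑ x, negMulLog (α + c * p x))) := by
    have := (hPc.tendsto 0).mono_left (nhdsWithin_le_nhds (s := Ioi 0))
    simpa [hP] using this
  refine le_of_tendsto hlim ?_
  filter_upwards [Ioo_mem_nhdsGT (zero_lt_one (α := ℝ))] with t ht
  have hu : ∀ x, 0 < uniformLaw X x := fun x => by unfold uniformLaw; positivity
  have hpos : ∀ x, 0 < P t x := fun x =>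
    add_pos_of_nonneg_of_pos (mul_nonneg (sub_nonneg.2 ht.2.le) (hp.1 x)) (mul_pos ht.1 (hu x))
  have hmem : P t ∈ stdSimplex ℝ X := by
    refine ⟨fun x => (hpos x).le, ?_⟩
    simp only [hP, Finset.sum_add_distrib, ← Finset.mul_sum, hp.2, sum_uniformLaw]
    ring
  obtain ⟨b, hb, hb1, hb2⟩ := exists_spike_of_pos h hmem hpos
  have hent : entropy p ≤ entropy (P t) := by
    have h1 : (1 - t) * entropy p + t * entropy (uniformLaw X) ≤ entropy (P t) := by
      simp only [entropy, Finset.mul_sum, ← Finset.sum_add_distrib]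
      exact Finset.sum_le_sum fun x _ => concaveOn_negMulLog.2 (hp.1 x) (hu x).le
        (sub_nonneg.2 ht.2.le) ht.1.le (by ring)
    rw [entropy_uniformLaw] at h1
    nlinarith [entropy_le_log_card hp, ht.1]
  have hba : b ≤ a := (strictMonoOn_spikeDiv h.one_lt).le_iff_le hb ha |>.1 (by linarith)
  exact hb2.trans (h.strictMonoOn_outDiv.monotoneOn hb ha hba)

theorem isGreatest_phiValues (h : HammingParam (Fintype.card X) α c)
    {a : ℝ} (ha : a ∈ Icc (1 / (Fintype.card X : ℝ)) 1) :
    IsGreatest (phiValues (hammingChannel X α) (spikeDiv (Fintype.card X) a))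
      (spikeDiv (Fintype.card X) (α + c * a)) := by
  have ha0 : a ∈ Icc (0 : ℝ) 1 := ⟨(one_div_mem_Ioo h.one_lt).1.le.trans ha.1, ha.2⟩
  have hX0 : (0 : ℝ) < Fintype.card X := by linarith [h.one_lt]
  obtain ⟨i⟩ : Nonempty X := Fintype.card_pos_iff.1 (by exact_mod_cast hX0)
  refine ⟨⟨spike i a, spike_mem_stdSimplex h.one_lt i ha0, (spikeDiv_eq i a).le,
    (outDiv_spike h i ha0).symm⟩, ?_⟩
  rintro v ⟨p, hp, hpR, rfl⟩
  exact outDiv_le h hp ha hpR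

theorem phi_spikeDiv (h : HammingParam (Fintype.card X) α c)
    {a : ℝ} (ha : a ∈ Icc (1 / (Fintype.card X : ℝ)) 1) :
    phi (hammingChannel X α) (spikeDiv (Fintype.card X) a) =
      spikeDiv (Fintype.card X) (α + c * a) :=
  (isGreatest_phiValues h ha).csSup_eq

theorem hasDerivAt_phi (h : HammingParam (Fintype.card X) α c)
    {a : ℝ} (ha : a ∈ Ioo (1 / (Fintype.card X : ℝ)) 1) :
    HasDerivAt (phi (hammingChannel X α)) (HammingParam.slope (Fintype.card X) α c a)
      (spikeDiv (Fintype.card X) a) := by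
  have ha0 : a ∈ Ioo (0 : ℝ) 1 := ⟨(one_div_mem_Ioo h.one_lt).1.trans ha.1, ha.2⟩
  have hs := hasStrictDerivAt_spikeDiv h.one_lt ha0
  have hne := (logOdds_pos h.one_lt ha).ne'
  have hg := (hs.to_localInverse hne).hasDerivAt
  have hga : hs.localInverse _ _ _ hne (spikeDiv (Fintype.card X) a) = a :=
    HasStrictFDerivAt.localInverse_apply_image ..
  have hV := h.hasDerivAt_outDiv ha0
  rw [← hga] at hV
  have hcomp := hV.comp _ hg
  rw [hga] at hcomp
  refine (hcomp.congr_deriv (div_eq_mul_inv _ _).symm).congr_of_eventuallyEq ?_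
  have hmem : ∀ᶠ R in 𝓝 (spikeDiv (Fintype.card X) a),
      hs.localInverse _ _ _ hne R ∈ Ioo (1 / (Fintype.card X : ℝ)) 1 :=
    hg.continuousAt.eventually (by rw [hga]; exact Ioo_mem_nhds ha.1 ha.2)
  filter_upwards [hmem, hs.eventually_right_inverse hne] with R hR1 hR2
  conv_lhs => rw [← hR2]
  exact phi_spikeDiv h ⟨hR1.1.le, hR1.2.le⟩

end Spike

/-- The mutual information of a uniform variable and a variable with law `w`, in terms of the
posterior laws `P t`. -/
theorem mutualInfo_eq_sum {A B : Type*} [Fintype A] [Fintype B] [Nonempty A] {r : A → B → ℝ}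
    {w : B → ℝ} {P : B → A → ℝ} (hr : ∀ a t, r a t = w t * P t a) (hP : ∀ t, ∑ a, P t a = 1)
    (hw : ∑ t, w t = 1) (hu : ∀ a, ∑ t, r a t = uniformLaw A a) :
    mutualInfo r = ∑ t, w t * (log (Fintype.card A) - entropy (P t)) := by
  have h1 : entropy (fun a => ∑ t, r a t) = log (Fintype.card A) := by
    rw [← entropy_uniformLaw]
    exact congrArg entropy (funext hu)
  have h2 : (fun t => ∑ a, r a t) = w := funext fun t => by
    simp only [hr, ← Finset.mul_sum, hP, mul_one]
  have h3 : entropy (fun at' : A × B => r at'.1 at'.2) =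
      entropy w + ∑ t, w t * entropy (P t) := by
    rw [entropy, Fintype.sum_prod_type, Finset.sum_comm, entropy, ← Finset.sum_add_distrib]
    refine Finset.sum_congr rfl fun t _ => ?_
    simp only [hr, negMulLog_mul, Finset.sum_add_distrib, ← Finset.sum_mul, hP, one_mul,
      ← Finset.mul_sum, entropy]
  rw [mutualInfo, h1, h2, h3]
  simp only [mul_sub, Finset.sum_sub_distrib, ← Finset.sum_mul, hw]
  ring

theorem exists_posterior {X T : Type*} [Fintype X] [Fintype T] [Nonempty X] {Q : X → T → ℝ}
    (hQ : IsChannel Q) : ∃ (w : T → ℝ) (P : T → X → ℝ), (∀ t, 0 ≤ w t) ∧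
      (∀ t, P t ∈ stdSimplex ℝ X) ∧ ∀ x t, jointLaw (uniformLaw X) Q x t = w t * P t x := by
  have hn : ∀ x t, 0 ≤ jointLaw (uniformLaw X) Q x t := fun x t =>
    mul_nonneg (uniformLaw_mem_stdSimplex.1 x) ((hQ x).1 t)
  have hw : ∀ t, 0 ≤ ∑ x, jointLaw (uniformLaw X) Q x t := fun t =>
    Finset.sum_nonneg fun x _ => hn x t
  have key : ∀ t, ∃ p ∈ stdSimplex ℝ X, ∀ x, jointLaw (uniformLaw X) Q x t =
      (∑ x, jointLaw (uniformLaw X) Q x t) * p x := fun t => by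
    rcases (hw t).eq_or_lt with h0 | h0
    · refine ⟨uniformLaw X, uniformLaw_mem_stdSimplex, fun x => ?_⟩
      rw [← h0, zero_mul]
      exact (Finset.sum_eq_zero_iff_of_nonneg fun x _ => hn x t).1 h0.symm x (Finset.mem_univ x)
    · refine ⟨fun x => jointLaw (uniformLaw X) Q x t / ∑ x, jointLaw (uniformLaw X) Q x t,
        ⟨fun x => div_nonneg (hn x t) (hw t), ?_⟩, fun x => ?_⟩
      · rw [← Finset.sum_div, div_self h0.ne']
      · field_simp
  choose P hP hPe using key
  exact ⟨_, P, hw, hP, fun x t => hPe t x⟩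

theorem mutualInfo_jointLaw {X T : Type*} [Fintype X] [Fintype T] [Nonempty X] {Q : X → T → ℝ}
    (hQ : IsChannel Q) {w : T → ℝ} {P : T → X → ℝ} (hP : ∀ t, P t ∈ stdSimplex ℝ X)
    (hr : ∀ x t, jointLaw (uniformLaw X) Q x t = w t * P t x) :
    ∑ t, w t = 1 ∧ mutualInfo (jointLaw (uniformLaw X) Q) =
      ∑ t, w t * (log (Fintype.card X) - entropy (P t)) := by
  have hu : ∀ x, ∑ t, jointLaw (uniformLaw X) Q x t = uniformLaw X x := fun x => by
    simp only [jointLaw, ← Finset.mul_sum, (hQ x).2, mul_one]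
  have hw : ∑ t, w t = 1 := by
    rw [← sum_uniformLaw (X := X)]
    simp only [← hu]
    rw [Finset.sum_comm]
    simp only [hr, ← Finset.mul_sum, (hP _).2, mul_one]
  exact ⟨hw, mutualInfo_eq_sum hr (fun t => (hP t).2) hw hu⟩

theorem exists_spikeDiv_eq_of_mem {X : Type*} [Fintype X] {α c : ℝ}
    (h : HammingParam (Fintype.card X) α c) {p : X → ℝ}
    (hp : p ∈ stdSimplex ℝ X) : ∃ a ∈ Icc (1 / (Fintype.card X : ℝ)) 1,
      spikeDiv (Fintype.card X) a = log (Fintype.card X) - entropy p := by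
  have hX0 : (0 : ℝ) < Fintype.card X := by linarith [h.three_le]
  have hne : Nonempty X := Fintype.card_pos_iff.1 (by exact_mod_cast hX0)
  exact exists_spikeDiv_eq h.one_lt ⟨by linarith [entropy_le_log_card hp],
    by linarith [entropy_nonneg hp]⟩

section Hamming

variable {X : Type*} [Fintype X] [DecidableEq X] {α c : ℝ}

theorem mutualInfo_markovLaw (h : HammingParam (Fintype.card X) α c) {T : Type*} [Fintype T]
    [Nonempty X] {Q : X → T → ℝ}
    (hQ : IsChannel Q) {w : T → ℝ} {P : T → X → ℝ} (hP : ∀ t, P t ∈ stdSimplex ℝ X)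
    (hr : ∀ x t, jointLaw (uniformLaw X) Q x t = w t * P t x) :
    mutualInfo (markovLaw (uniformLaw X) (hammingChannel X α) Q) =
      ∑ t, w t * (log (Fintype.card X) - entropy (outputLaw (P t) (hammingChannel X α))) := by
  have hX0 : (Fintype.card X : ℝ) ≠ 0 := by linarith [h.three_le]
  refine mutualInfo_eq_sum (fun y t => ?_) (fun t => ?_) (mutualInfo_jointLaw hQ hP hr).1
    fun y => ?_
  · rw [markovLaw, outputLaw, Finset.mul_sum]
    refine Finset.sum_congr rfl fun x _ => ?_
    rw [← mul_assoc, ← hr, jointLaw]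
    ring
  · simp only [outputLaw_hammingChannel h.sum_eq (hP t).2, Finset.sum_add_distrib,
      ← Finset.mul_sum, (hP t).2]
    simpa using h.sum_eq
  · simp only [markovLaw]
    rw [Finset.sum_comm]
    simp only [← Finset.mul_sum, (hQ _).2, mul_one]
    have := outputLaw_hammingChannel h.sum_eq (sum_uniformLaw (X := X)) y
    rw [outputLaw] at this
    rw [this]
    exact h.out_one_div

/-- A bound of the output divergence by an affine function of the input divergence passes to the
values of the information bottleneck problem. -/
theorem ibValues_le_of_forall_le (h : HammingParam (Fintype.card X) α c) {R s e v : ℝ}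
    (hs : 0 ≤ s) (hle : ∀ p ∈ stdSimplex ℝ X,
      log (Fintype.card X) - entropy (outputLaw p (hammingChannel X α)) ≤
        e + s * (log (Fintype.card X) - entropy p))
    (hv : v ∈ ibValues (uniformLaw X) (hammingChannel X α) R) : v ≤ e + s * R := by
  have hX0 : (0 : ℝ) < Fintype.card X := by linarith [h.three_le]
  have hne : Nonempty X := Fintype.card_pos_iff.1 (by exact_mod_cast hX0)
  obtain ⟨m, Q, hQ, hR, rfl⟩ := hv
  obtain ⟨w, P, hw, hP, hr⟩ := exists_posterior hQ
  obtain ⟨hw1, hI⟩ := mutualInfo_jointLaw hQ hP hr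
  rw [hI] at hR
  rw [mutualInfo_markovLaw h hQ hP hr]
  calc _ ≤ ∑ t, w t * (e + s * (log (Fintype.card X) - entropy (P t))) :=
        Finset.sum_le_sum fun t _ => mul_le_mul_of_nonneg_left (hle _ (hP t)) (hw t)
    _ = e + s * ∑ t, w t * (log (Fintype.card X) - entropy (P t)) := by
        simp only [mul_add, Finset.sum_add_distrib, ← Finset.sum_mul, hw1, one_mul,
          Finset.mul_sum]
        congr 1
        exact Finset.sum_congr rfl fun t _ => by ring
    _ ≤ e + s * R := by gcongr

/-- The mixture, with weights `μ` and `1 - μ`, of a symmetric channel and of a constant one. -/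
theorem mem_ibValues (h : HammingParam (Fintype.card X) α c) {a μ : ℝ}
    (ha : a ∈ Icc (0 : ℝ) 1) (hμ : μ ∈ Icc (0 : ℝ) 1) :
    μ * spikeDiv (Fintype.card X) (α + c * a) ∈
      ibValues (uniformLaw X) (hammingChannel X α) (μ * spikeDiv (Fintype.card X) a) := by
  have hX0 : (0 : ℝ) < Fintype.card X := by linarith [h.three_le]
  have hne : Nonempty X := Fintype.card_pos_iff.1 (by exact_mod_cast hX0)
  let w : Option X → ℝ := fun o => o.elim (1 - μ) fun _ => μ / Fintype.card X
  let P : Option X → X → ℝ := fun o => o.elim (uniformLaw X) fun i => spike i a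
  let f := (Fintype.equivFin (Option X)).symm
  have hw : ∀ o, 0 ≤ w o := by
    rintro (_ | i)
    · exact sub_nonneg.2 hμ.2
    · exact div_nonneg hμ.1 hX0.le
  have hP : ∀ o, P o ∈ stdSimplex ℝ X := by
    rintro (_ | i)
    · exact uniformLaw_mem_stdSimplex
    · exact spike_mem_stdSimplex h.one_lt i ha
  have hsum : ∀ x, ∑ o, w o * P o x = uniformLaw X x := fun x => by
    have hs : ∑ i, spike i a x = 1 := by
      rw [← (spike_mem_stdSimplex h.one_lt x ha).2]
      exact Finset.sum_congr rfl fun i _ => by simp only [spike, eq_comm]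
    rw [Fintype.sum_option]
    simp only [w, P, Option.elim, ← Finset.mul_sum, hs, uniformLaw]
    ring
  set Q : X → Fin (Fintype.card (Option X)) → ℝ :=
    fun x t => Fintype.card X * (w (f t) * P (f t) x) with hQdef
  have hQ : IsChannel Q := by
    refine fun x => ⟨fun t => mul_nonneg hX0.le (mul_nonneg (hw _) ((hP _).1 x)), ?_⟩
    simp only [hQdef, ← Finset.mul_sum]
    rw [Equiv.sum_comp f fun o => w o * P o x, hsum, uniformLaw]
    field_simp
  have hr : ∀ x t, jointLaw (uniformLaw X) Q x t = w (f t) * P (f t) x := fun x t => by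
    simp only [jointLaw, hQdef, uniformLaw]
    field_simp
  refine ⟨_, Q, hQ, le_of_eq ?_, ?_⟩
  · rw [(mutualInfo_jointLaw hQ (fun t => hP (f t)) hr).2,
      Equiv.sum_comp f fun o => w o * (log (Fintype.card X) - entropy (P o)), Fintype.sum_option]
    simp only [w, P, Option.elim, spikeDiv_eq, entropy_uniformLaw, Finset.sum_const,
      Finset.card_univ, nsmul_eq_mul]
    field_simp
    ring
  · have hu : entropy (outputLaw (uniformLaw X) (hammingChannel X α)) = log (Fintype.card X) := by
      rw [← entropy_uniformLaw]
      exact congrArg entropy (funext fun y =>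
        (outputLaw_hammingChannel h.sum_eq sum_uniformLaw y).trans h.out_one_div)
    rw [mutualInfo_markovLaw h hQ (fun t => hP (f t)) hr,
      Equiv.sum_comp f fun o => w o *
        (log (Fintype.card X) - entropy (outputLaw (P o) (hammingChannel X α))),
      Fintype.sum_option]
    simp only [w, P, Option.elim, outDiv_spike h _ ha, hu, Finset.sum_const,
      Finset.card_univ, nsmul_eq_mul]
    field_simp
    ring

/-- The values of the information bottleneck problem lie below every line that lies above the
curve of the spikes. -/
theorem ibValues_le (h : HammingParam (Fintype.card X) α c) {R s e v : ℝ} (hs : 0 ≤ s)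
    (hle : ∀ a ∈ Icc (1 / (Fintype.card X : ℝ)) 1,
      spikeDiv (Fintype.card X) (α + c * a) ≤ e + s * spikeDiv (Fintype.card X) a)
    (hv : v ∈ ibValues (uniformLaw X) (hammingChannel X α) R) : v ≤ e + s * R := by
  refine ibValues_le_of_forall_le h hs (fun p hp => ?_) hv
  obtain ⟨a, ha, hap⟩ := exists_spikeDiv_eq_of_mem h hp
  rw [← hap]
  exact (outDiv_le h hp ha hap.ge).trans (hle a ha)

end Hamming

end InfoBottleneck

theorem mainTheorem6 {X : Type*} [Fintype X] [DecidableEq X] (n : ℕ) (hn : 3 ≤ n)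
    (hX : Fintype.card X = n) (α : ℝ)
    (hα : α ∈ Ioo (0 : ℝ) (1 / n) ∪ Ioo (1 / (n : ℝ)) (1 / ((n : ℝ) - 1)))
    (φ IB : ℝ → ℝ)
    (hφ : φ = InfoBottleneck.phi (InfoBottleneck.hammingChannel X α))
    (hIB : IB = InfoBottleneck.ib (InfoBottleneck.uniformLaw X)
      (InfoBottleneck.hammingChannel X α)) :
    -- the joint distribution of `X` and `Y` has full support
    (∀ x y : X, 0 < InfoBottleneck.jointLaw (InfoBottleneck.uniformLaw X)
      (InfoBottleneck.hammingChannel X α) x y) ∧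
    -- the suprema that define `φ(R)` and `IB(R)` are maxima
    (∀ R ∈ Icc (0 : ℝ) (Real.log n),
      IsGreatest (InfoBottleneck.phiValues (InfoBottleneck.hammingChannel X α) R) (φ R)) ∧
    (∀ R ∈ Icc (0 : ℝ) (Real.log n),
      IsGreatest (InfoBottleneck.ibValues (InfoBottleneck.uniformLaw X)
        (InfoBottleneck.hammingChannel X α) R) (IB R)) ∧
    DifferentiableOn ℝ φ (Ioo 0 (Real.log n)) ∧
    ∃ Rc ∈ Ioo (0 : ℝ) (Real.log n),
      -- `Rc` is the unique point of `(0, log n)` with `φ'(Rc) = φ(Rc) / Rc`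
      deriv φ Rc = φ Rc / Rc ∧
      (∀ R ∈ Ioo (0 : ℝ) (Real.log n), deriv φ R = φ R / R → R = Rc) ∧
      -- the formula for the IB function
      (∀ R ∈ Icc (0 : ℝ) Rc, IB R = φ Rc / Rc * R) ∧
      (∀ R ∈ Ioc Rc (Real.log n), IB R = φ R) := by
  open InfoBottleneck in
  subst hX hφ hIB
  have h3 : (3 : ℝ) ≤ Fintype.card X := by exact_mod_cast hn
  have h : HammingParam (Fintype.card X) α (1 - Fintype.card X * α) := by
    have hX0 : (0 : ℝ) < Fintype.card X := by linarith
    have hX1 : (0 : ℝ) < Fintype.card X - 1 := by linarith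
    rcases hα with ⟨h1, h2⟩ | ⟨h1, h2⟩
    · rw [lt_div_iff₀ hX0] at h2
      exact ⟨h3, h1, by nlinarith, by nlinarith, by ring⟩
    · have h0 : 0 < α := (one_div_pos.2 hX0).trans h1
      rw [div_lt_iff₀ hX0] at h1
      rw [lt_div_iff₀ hX1] at h2
      exact ⟨h3, h0, by nlinarith, by nlinarith, by ring⟩
  set c : ℝ := 1 - Fintype.card X * α
  set N : ℝ := (Fintype.card X : ℝ)
  have hu := one_div_mem_Ioo h.one_lt
  have hmono := (strictMonoOn_spikeDiv h.one_lt)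
  have hIoo : ∀ R ∈ Ioo 0 (Real.log N), ∃ a ∈ Ioo (1 / N) 1, spikeDiv N a = R := fun R hR => by
    obtain ⟨a, ha, rfl⟩ := exists_spikeDiv_eq h.one_lt ⟨hR.1.le, hR.2.le⟩
    refine ⟨a, ⟨ha.1.lt_of_ne ?_, ha.2.lt_of_ne ?_⟩, rfl⟩
    · rintro rfl
      exact hR.1.ne (spikeDiv_one_div h.one_lt).symm
    · rintro rfl
      exact hR.2.ne spikeDiv_one
  obtain ⟨k, hk, hks, huniq, htan⟩ := h.exists_tangent
  have hkI : k ∈ Icc (1 / N) 1 := ⟨hk.1.le, hk.2.le⟩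
  have hDk : 0 < spikeDiv N k := spikeDiv_pos h.one_lt ⟨hk.1, hk.2.le⟩
  have hDk1 : spikeDiv N k < Real.log N := by
    rw [← spikeDiv_one]
    exact hmono hkI ⟨hu.2.le, le_rfl⟩ hk.2
  have hφk := phi_spikeDiv h hkI
  have hlow : ∀ R ∈ Icc 0 (spikeDiv N k),
      IsGreatest (ibValues (uniformLaw X) (hammingChannel X α) R)
        (phi (hammingChannel X α) (spikeDiv N k) / spikeDiv N k * R) := fun R hR => by
    rw [hφk]
    constructor
    · have := mem_ibValues h (a := k) (μ := R / spikeDiv N k) ⟨hu.1.le.trans hk.1.le, hk.2.le⟩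
        ⟨div_nonneg hR.1 hDk.le, (div_le_one hDk).2 hR.2⟩
      rw [div_mul_cancel₀ _ hDk.ne'] at this
      convert this using 1
      ring
    · intro v hv
      rw [← hks]
      have := ibValues_le h (e := 0) (h.slope_pos hk).le (fun a ha => ?_) hv
      · linarith
      · have h1 := htan k ⟨le_rfl, hk.2⟩ a ha
        rw [eq_div_iff hDk.ne'] at hks
        linarith
  have hhigh : ∀ R ∈ Ioc (spikeDiv N k) (Real.log N),
      IsGreatest (ibValues (uniformLaw X) (hammingChannel X α) R)
        (phi (hammingChannel X α) R) := fun R hR => by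
    obtain ⟨a, ha, rfl⟩ := exists_spikeDiv_eq h.one_lt ⟨hDk.le.trans hR.1.le, hR.2⟩
    have hka : k < a := (hmono.lt_iff_lt hkI ha).1 hR.1
    rw [phi_spikeDiv h ha]
    constructor
    · have := mem_ibValues h (a := a) (μ := 1) ⟨hu.1.le.trans ha.1, ha.2⟩ ⟨zero_le_one, le_rfl⟩
      rwa [one_mul, one_mul] at this
    · intro v hv
      rcases ha.2.eq_or_lt with rfl | ha1
      · have := ibValues_le h (e := spikeDiv N (α + c * 1)) le_rfl (fun b hb => ?_) hv
        · linarith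
        · rw [zero_mul, add_zero]
          exact h.strictMonoOn_outDiv.monotoneOn hb ha hb.2
      · have := ibValues_le h (e := spikeDiv N (α + c * a) -
          HammingParam.slope N α c a * spikeDiv N a)
          (h.slope_pos ⟨hk.1.trans hka, ha1⟩).le (fun b hb => ?_) hv
        · linarith
        · have := htan a ⟨hka.le, ha1⟩ b hb
          linarith
  refine ⟨fun x y => ?_, fun R hR => ?_, fun R hR => ?_, fun R hR => ?_, spikeDiv N k,
    ⟨hDk, hDk1⟩, ?_, fun R hR hd => ?_, fun R hR => (hlow R hR).csSup_eq,
    fun R hR => (hhigh R hR).csSup_eq⟩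
  · have hX0 : (0 : ℝ) < Fintype.card X := by linarith
    refine mul_pos (one_div_pos.2 hX0) ?_
    unfold hammingChannel
    split_ifs
    · have := h.add_pos
      linarith
    · exact h.pos
  · obtain ⟨a, ha, rfl⟩ := exists_spikeDiv_eq h.one_lt hR
    rw [phi_spikeDiv h ha]
    exact isGreatest_phiValues h ha
  · rcases le_or_gt R (spikeDiv N k) with hRk | hRk
    · have := hlow R ⟨hR.1, hRk⟩
      rwa [← this.csSup_eq] at this
    · have := hhigh R ⟨hRk, hR.2⟩
      rwa [← this.csSup_eq] at this
  · obtain ⟨a, ha, rfl⟩ := hIoo R hR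
    exact (hasDerivAt_phi h ha).differentiableAt.differentiableWithinAt
  · rw [(hasDerivAt_phi h hk).deriv, hφk, hks]
  · obtain ⟨a, ha, rfl⟩ := hIoo R hR
    rw [(hasDerivAt_phi h ha).deriv, phi_spikeDiv h ⟨ha.1.le, ha.2.le⟩] at hd
    rw [huniq a ha hd]
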